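/- For $f\in L^\infty(\mathbb R)$ the Fourier transform $\hat f$ is the tempered distribution $\hat f=\hat f_1-\Psi_f''$, where $\hat f_1(s)=\int_{-1}^1e^{-ist}f(t)\,dt$, $\Psi_f(s)=\int_{|t|>1}e^{-ist}f(t)\,\frac{dt}{t^2}$ and the derivatives are distributional; that is, $\langle\hat f,\phi\rangle=\int_{-\infty}^\infty \hat f_1(s)\phi(s)\,ds-\int_{-\infty}^\infty\Psi_f(s)\phi''(s)\,ds$ for every Schwartz function $\phi$. Let $\delta$ be the Dirac distribution at $0$, $J_0$, $J_1$ the Bessel functions of the first kind, and let $a\in\mathbb R$, $a\neq0$. 1. The function $f(x)=\cos(a/x)$ belongs to $L^\infty(\mathbb R)$ and to no $L^p(\mathbb R)$ with $0<p<\infty$, and is not of bounded variation on $\mathbb R$. For every $s\in\mathbb R$ the integral $\int_{-\infty}^\infty e^{-ist}\cos(a/t)\,dt$ diverges as a Henstock--Kurzweil integral and as a distributional integral: $t\mapsto e^{-ist}\cos(a/t)$ is not the $n$-th distributional derivative of a continuous function with finite limits at $\pm\infty$, for any $n\ge1$, and is not the distributional derivative of an $L^p$ function, for any $1\le p<\infty$.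 Its Fourier transform is $$\hat f(s)=2\pi\delta(s)-\frac{\pi\sqrt{|a|}\,J_1(2\sqrt{|as|})}{\sqrt{|s|}}.$$ This assigns a value to divergent integrals: in the sense of convergence of the truncated integrals ($\int_0^R$ with $R\to\infty$, respectively $\int_r^\infty$ with $r\to0^+$) as tempered distributions in $s$, $$\int_0^\infty\cos(st)\cos(a/t)\,dt=\int_0^\infty\cos(s/t)\cos(at)\,\frac{dt}{t^2}=\pi\delta(s)-\frac{\pi\sqrt{|a|}\,J_1(2\sqrt{|as|})}{2\sqrt{|s|}}.$$ 2. The function $g(x)=e^{ia/x}$ is in $L^\infty(\mathbb R)$ and $$\hat g(s)=2\pi\delta(s)-\begin{cases}\dfrac{2\pi\sqrt{|a|}\,J_1(2\sqrt{|as|})}{\sqrt{|s|}},& as<0,\\ 0,& as\ge0,\end{cases}$$ and $\int_{-R}^{R}\cos(st-a/t)\,dt$ converges to the same distribution as $R\to\infty$, as tempered distributions in $s$. 3. The function $h(x)=x\sin(a/x)$ is in $L^\infty(\mathbb R)$ and $$\hat h(s)=2\pi a\,\delta(s)+\frac{\pi a\,J_0(2\sqrt{|as|})}{|s|}-\frac{\pi\sqrt{|a|}\,\mathrm{sgn}(a)\,J_1(2\sqrt{|as|})}{|s|^{3/2}}.$$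 4. For $m\in\mathbb N$ the function $f_m(x)=\cos^m(a/x)$ is in $L^\infty(\mathbb R)$, and for every integer $n\ge1$ $$\hat f_{2n-1}(s)=2\pi\delta(s)-\frac{\pi}{2^{2n-2}}\sum_{k=0}^{n-1}\binom{2n-1}{k}\left|\frac{(2n-2k-1)a}{s}\right|^{1/2}J_1\!\left(2|(2n-2k-1)as|^{1/2}\right),$$ $$\hat f_{2n}(s)=2\pi\delta(s)-\frac{\pi}{2^{2n-1}}\sum_{k=0}^{n-1}\binom{2n}{k}\left|\frac{(2n-2k)a}{s}\right|^{1/2}J_1\!\left(2|(2n-2k)as|^{1/2}\right).$$ In each formula the term besides the multiple of $\delta$ is a function whose product with every Schwartz function is integrable; it acts by integration. -/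

import Mathlib

open MeasureTheory Filter Topology Set
open scoped ENNReal SchwartzMap

noncomputable section

namespace BoundedFourier

/-- The Bessel function `J_n` of the first kind of integer order `n ≥ 0`, on the real line. -/
def besselJ (n : ℕ) (z : ℝ) : ℝ :=
  ∑' k : ℕ, (-1 : ℝ) ^ k / (k.factorial * (k + n).factorial) * (z / 2) ^ (2 * k + n)

theorem summable_besselJ (n : ℕ) (z : ℝ) :
    Summable fun k : ℕ =>
      (-1 : ℝ) ^ k / (k.factorial * (k + n).factorial) * (z / 2) ^ (2 * k + n) := by
  have h := (Real.summable_pow_div_factorial ((z / 2) ^ 2)).mul_left |(z / 2) ^ n|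
  refine Summable.of_norm_bounded h fun k => ?_
  have h1 : (1 : ℝ) ≤ ((k + n).factorial : ℝ) := by exact_mod_cast Nat.succ_le_of_lt (Nat.factorial_pos _)
  have h2 : (0 : ℝ) < (k.factorial : ℝ) := by exact_mod_cast Nat.factorial_pos _
  have e : ‖(-1 : ℝ) ^ k / (k.factorial * (k + n).factorial) * (z / 2) ^ (2 * k + n)‖
      = (|(z / 2) ^ n| * (((z / 2) ^ 2) ^ k / k.factorial)) / (k + n).factorial := by
    rw [norm_mul, norm_div, norm_pow, norm_neg, norm_one, one_pow, norm_mul, pow_add, pow_mul,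
      norm_mul, Real.norm_eq_abs, Real.norm_eq_abs, Real.norm_eq_abs, Real.norm_eq_abs,
      Nat.abs_cast, Nat.abs_cast, abs_of_nonneg (by positivity : 0 ≤ ((z / 2) ^ 2) ^ k)]
    field_simp
  rw [e]
  exact div_le_self (by positivity) h1

/-- `s ↦ ∫_{-1}^{1} e^{-ist} f(t) dt`. -/
def innerTransform (f : ℝ → ℂ) (s : ℝ) : ℂ :=
  ∫ t in Icc (-1 : ℝ) 1, Complex.exp (-(Complex.I * s * t)) * f t

/-- `Ψ_f(s) = ∫_{|t|>1} e^{-ist} f(t) dt / t²`. -/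
def Psi (f : ℝ → ℂ) (s : ℝ) : ℂ :=
  ∫ t in {t : ℝ | 1 < |t|}, Complex.exp (-(Complex.I * s * t)) * f t / (t : ℂ) ^ 2

theorem norm_kernel (s t : ℝ) : ‖Complex.exp (-(Complex.I * s * t))‖ = 1 := by
  have : -(Complex.I * s * t) = ((-(s * t) : ℝ) : ℂ) * Complex.I := by push_cast; ring
  rw [this, Complex.norm_exp_ofReal_mul_I]

theorem memLp_transform {μ : Measure ℝ} {G : ℝ → ℂ} (hG : Integrable G μ) :
    MemLp (fun s : ℝ => ∫ t, Complex.exp (-(Complex.I * s * t)) * G t ∂μ) ∞ volume := by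
  have hc : Continuous fun s : ℝ => ∫ t, Complex.exp (-(Complex.I * s * t)) * G t ∂μ := by
    refine continuous_of_dominated (bound := fun t => ‖G t‖) (fun s => ?_) (fun s => ?_)
      hG.norm ?_
    · exact (Continuous.aestronglyMeasurable (by fun_prop)).mul hG.aestronglyMeasurable
    · exact Eventually.of_forall fun t => by rw [norm_mul, norm_kernel, one_mul]
    · exact Eventually.of_forall fun t => by fun_prop
  refine memLp_top_of_bound hc.aestronglyMeasurable (∫ t, ‖G t‖ ∂μ)
    (Eventually.of_forall fun s => ?_)
  refine (norm_integral_le_integral_norm _).trans (le_of_eq ?_)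
  simp only [norm_mul, norm_kernel, one_mul]

theorem memLp_innerTransform {f : ℝ → ℂ} (hf : MemLp f ∞ volume) :
    MemLp (innerTransform f) ∞ volume :=
  memLp_transform ((hf.restrict (Icc (-1 : ℝ) 1)).integrable le_top)

theorem memLp_Psi {f : ℝ → ℂ} (hf : MemLp f ∞ volume) : MemLp (Psi f) ∞ volume := by
  have hm : MeasurableSet {t : ℝ | 1 < |t|} := measurableSet_lt measurable_const measurable_abs
  have hb : IntegrableOn (fun t : ℝ => ((t : ℂ) ^ 2)⁻¹) {t : ℝ | 1 < |t|} := by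
    refine Integrable.mono' ((integrable_inv_one_add_sq.const_mul 2).integrableOn)
      (Measurable.aestronglyMeasurable (by fun_prop)) ?_
    refine (ae_restrict_iff' hm).2 (Eventually.of_forall fun t ht => ?_)
    have h1 : 1 < t ^ 2 := by
      have : (1 : ℝ) < |t| := ht
      nlinarith [sq_abs t]
    rw [norm_inv, norm_pow, Complex.norm_real, Real.norm_eq_abs, sq_abs, ← div_eq_mul_inv,
      inv_eq_one_div, div_le_div_iff₀ (by linarith) (by linarith)]
    linarith
  have hi : Integrable (fun t : ℝ => f t / (t : ℂ) ^ 2) (volume.restrict {t : ℝ | 1 < |t|}) := by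
    simp only [div_eq_mul_inv]
    exact Integrable.bdd_mul (c := (eLpNorm f ∞ volume).toReal) hb
      hf.aestronglyMeasurable.restrict
      (ae_restrict_of_ae (by
        filter_upwards [ae_le_eLpNormEssSup (f := f) (μ := volume)] with t ht
        rw [eLpNorm_exponent_top]
        have hfin : eLpNormEssSup f volume ≠ ∞ := by
          rw [← eLpNorm_exponent_top]; exact hf.2.ne
        rw [← toReal_enorm]
        exact ENNReal.toReal_mono hfin ht))
  have h := memLp_transform hi
  have e : Psi f = fun s : ℝ => ∫ t in {t : ℝ | 1 < |t|},
      Complex.exp (-(Complex.I * s * t)) * (f t / (t : ℂ) ^ 2) := by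
    funext s
    simp only [Psi, mul_div_assoc]
  rw [e]
  exact h

/-- The Fourier transform of a bounded measurable function as a tempered distribution:
`f̂ = f̂₁ - Ψ_f''`, where `f̂₁` is the ordinary transform of `f` restricted to `[-1, 1]` and the
derivatives of `Ψ_f` are distributional. -/
def fourier (f : ℝ → ℂ) (hf : MemLp f ∞ volume) : 𝓢'(ℝ, ℂ) :=
  Lp.toTemperedDistribution ((memLp_innerTransform hf).toLp (innerTransform f)) -
    TemperedDistribution.derivCLM ℂ (TemperedDistribution.derivCLM ℂ
      (Lp.toTemperedDistribution ((memLp_Psi hf).toLp (Psi f))))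

theorem fourier_apply (f : ℝ → ℂ) (hf : MemLp f ∞ volume) (φ : 𝓢(ℝ, ℂ)) :
    fourier f hf φ =
      (∫ s, innerTransform f s * φ s) - ∫ s, Psi f s * deriv (deriv φ) s := by
  have e1 : ∀ {g : ℝ → ℂ} (hg : MemLp g ∞ volume) (ψ : 𝓢(ℝ, ℂ)),
      Lp.toTemperedDistribution (hg.toLp g) ψ = ∫ s, g s * ψ s := by
    intro g hg ψ
    rw [Lp.toTemperedDistribution_apply]
    refine integral_congr_ae ?_
    filter_upwards [hg.coeFn_toLp] with s hs
    rw [hs, smul_eq_mul, mul_comm]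
  have e2 : ∀ T : 𝓢'(ℝ, ℂ), TemperedDistribution.derivCLM ℂ (TemperedDistribution.derivCLM ℂ T) φ
      = T (SchwartzMap.derivCLM ℂ ℂ (SchwartzMap.derivCLM ℂ ℂ φ)) := by
    intro T
    simp
  have e3 : ∀ s, SchwartzMap.derivCLM ℂ ℂ (SchwartzMap.derivCLM ℂ ℂ φ) s = deriv (deriv φ) s := by
    intro s
    rw [SchwartzMap.derivCLM_apply]
    congr 1
  change Lp.toTemperedDistribution ((memLp_innerTransform hf).toLp (innerTransform f)) φ -
    TemperedDistribution.derivCLM ℂ (TemperedDistribution.derivCLM ℂ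
      (Lp.toTemperedDistribution ((memLp_Psi hf).toLp (Psi f)))) φ = _
  rw [e2, e1, e1]
  simp only [e3]

/-- The tempered distribution `T` equals `c δ + K`, with `δ` the Dirac distribution at `0` and
`K` a function that defines a regular tempered distribution. -/
def EqDeltaAdd (T : 𝓢'(ℝ, ℂ)) (c : ℂ) (K : ℝ → ℂ) : Prop :=
  ∀ φ : 𝓢(ℝ, ℂ), Integrable (fun s => K s * φ s) ∧
    T φ = c * TemperedDistribution.delta (0 : ℝ) φ + ∫ s, K s * φ s

/-- The functions `u_R` converge to `c δ + K` in the space of tempered distributions, along the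
filter `l`. -/
def TendstoDeltaAdd {ι : Type} (u : ι → ℝ → ℂ) (l : Filter ι) (c : ℂ) (K : ℝ → ℂ) : Prop :=
  ∀ φ : 𝓢(ℝ, ℂ), Integrable (fun s => K s * φ s) ∧
    (∀ᶠ R in l, Integrable (fun s => u R s * φ s)) ∧
    Tendsto (fun R => ∫ s, u R s * φ s) l
      (𝓝 (c * TemperedDistribution.delta (0 : ℝ) φ + ∫ s, K s * φ s))

/-- `⊥ = x_0 < x_1 < ⋯ < x_n = ⊤` is a partition of the extended real line with tags
`z_i ∈ [x_i, x_{i+1}]` such that `[x_i, x_{i+1}] ⊆ γ(z_i)`. -/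
def IsFinePartition (γ : EReal → Set EReal) (n : ℕ) (x z : ℕ → EReal) : Prop :=
  x 0 = ⊥ ∧ x n = ⊤ ∧ ∀ i < n, x i < x (i + 1) ∧ z i ∈ Icc (x i) (x (i + 1)) ∧
    Icc (x i) (x (i + 1)) ⊆ γ (z i)

/-- The Riemann sum of `u` over a tagged partition of the extended real line, where `u` has the
value `0` at `±∞` and `0 · ∞ = 0`. -/
def riemannSum (u : ℝ → ℂ) (n : ℕ) (x z : ℕ → EReal) : ℂ :=
  ∑ i ∈ Finset.range n, if z i = ⊥ ∨ z i = ⊤ then 0 else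
    (((x (i + 1)).toReal - (x i).toReal : ℝ) : ℂ) * u (z i).toReal

/-- Henstock–Kurzweil integrability over `[-∞, ∞]`. A gauge assigns to each point of the extended
line a neighbourhood of it. (A gauge may always be shrunk so that `γ z` is a bounded set of reals
for real `z`; then every interval with a real tag has finite end points.) -/
def HKIntegrable (u : ℝ → ℂ) : Prop :=
  ∃ A : ℂ, ∀ ε > 0, ∃ γ : EReal → Set EReal, (∀ z, γ z ∈ 𝓝 z) ∧
    ∀ n x z, IsFinePartition γ n x z → ‖riemannSum u n x z - A‖ < ε

/-- `u` is the `n`-th distributional derivative of `F` on the real line. -/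
def IsDistribDeriv (n : ℕ) (F u : ℝ → ℂ) : Prop :=
  ∀ φ : ℝ → ℂ, ContDiff ℝ ((⊤ : ℕ∞) : WithTop ℕ∞) φ → HasCompactSupport φ →
    ∫ t, u t * φ t = (-1) ^ n * ∫ t, F t * iteratedDeriv n φ t

/-- `u` has an `n`-th order distributional (continuous primitive) integral over the line: it is
the `n`-th distributional derivative of a function that is continuous on `[-∞, ∞]`. For `n = 1`
this is the distributional Denjoy integral. -/
def DistribIntegrable (n : ℕ) (u : ℝ → ℂ) : Prop :=
  ∃ F : ℝ → ℂ, Continuous F ∧ (∃ l, Tendsto F atBot (𝓝 l)) ∧ (∃ l, Tendsto F atTop (𝓝 l)) ∧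
    IsDistribDeriv n F u

/-- `u` has an `L^p` primitive integral: it is the distributional derivative of an `L^p`
function. -/
def LpPrimitiveIntegrable (p : ℝ≥0∞) (u : ℝ → ℂ) : Prop :=
  ∃ F : ℝ → ℂ, MemLp F p volume ∧ IsDistribDeriv 1 F u

end BoundedFourier

end

noncomputable section

namespace BoundedFourier

/-! The transforms rest on the multiplication formula `fourier_apply_eq_integral_hat`: the pairing
of f̂ with φ is ∫ f φ̂. Each transform thus becomes an identity for ∫ f φ̂, recorded as
`HasTransform`, a relation closed under linear combinations.

The one real computation concerns e^{-ia/t} with a > 0. Write J_n(2√w) = w^{n/2} E_n(w), where E_n =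
`besselSeries n` is entire. Termwise integration gives ∫_0^∞ a E_1(as) e^{-ps} ds = 1 - e^{-a/p} for
Re p > 0. With p = ε - it, Fubini and Fourier inversion turn this into a formula for ∫ φ̂(t) (1 -
e^{-a/(ε-it)}) dt, and ε → 0+ yields the transform. Dominated convergence needs |e^{-a/p}| ≤ 1 and
|E_1| ≤ 1 on [0, ∞) (`abs_besselSeries_le_one`). A reflection gives the other sign of a, and
averaging the two signs gives the cosine.

For x sin(a/x), the factor t is absorbed by t φ̂ = -i (φ')^. An integration by parts with E_1' =
-E_2 then produces δ from the jump of the kernel at 0, and the recurrence E_0 = E_1 - w E_2 brings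
in J_0. Powers of the cosine reduce to cosines of multiples by the binomial theorem. Truncated
integrals converge because f φ̂ is integrable and Fubini moves the truncation onto ∫ f φ̂.

Divergence comes from infinity: there cos(a/t) → 1, so after removal of the phase e^{-ist} the
integrand keeps a fixed positive mass on far windows of fixed length. This contradicts the Cauchy
criterion for Henstock–Kurzweil sums (`HKIntegrable.norm_lt`), and also the vanishing at infinity of
the pairings of a distributional derivative with translated test functions
(`not_isDistribDeriv_of_tendsto`). -/

/-! ### Lebesgue spaces and bounded variation of cos(a/x) -/

theorem tendsto_cos_div_atTop (a : ℝ) : Tendsto (fun t : ℝ => Real.cos (a / t)) atTop (𝓝 1) := by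
  have h : Tendsto (fun t : ℝ => a / t) atTop (𝓝 0) := tendsto_const_nhds.div_atTop tendsto_id
  rw [← Real.cos_zero]
  exact (Real.continuous_cos.tendsto 0).comp h

/-- The function exceeds 1/2 on a half-line, which has infinite measure, whereas superlevel sets of
an L^p function have finite measure. -/
theorem not_memLp_cos_div (a : ℝ) (p : ℝ≥0∞) (h0 : p ≠ 0) (hp : p ≠ ∞) :
    ¬ MemLp (fun x : ℝ => ((Real.cos (a / x) : ℝ) : ℂ)) p volume := by
  intro h
  obtain ⟨M, hM⟩ := eventually_atTop.1
    ((tendsto_cos_div_atTop a).eventually (lt_mem_nhds (by norm_num : (1 / 2 : ℝ) < 1)))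
  have h1 := h.meas_ge_lt_top h0 hp (ε := 1 / 2) (by norm_num)
  have h2 : volume (Ici M) ≤
      volume {x : ℝ | (1 / 2 : NNReal) ≤ ‖((Real.cos (a / x) : ℝ) : ℂ)‖₊} := by
    refine measure_mono fun x hx => ?_
    have h3 := hM x hx
    rw [mem_ofPred_eq, ← NNReal.coe_le_coe, coe_nnnorm, Complex.norm_real, Real.norm_eq_abs]
    push_cast
    exact h3.le.trans (le_abs_self _)
  rw [Real.volume_Ici] at h2
  exact absurd h1 (not_lt.2 (by simpa using h2))

theorem not_boundedVariationOn_cos_div {a : ℝ} (ha : a ≠ 0) :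
    ¬ BoundedVariationOn (fun x : ℝ => Real.cos (a / x)) univ := by
  intro h
  -- The sample points increase to 0 from the left, as a monotone sequence must, and the values
  -- alternate between -1 and 1.
  have hval : ∀ i : ℕ, Real.cos (a / (-|a| / (Real.pi * (i + 1)))) = (-1) ^ (i + 1) := by
    intro i
    have h1 : |a / (-|a| / (Real.pi * (i + 1)))| = ((i + 1 : ℕ) : ℝ) * Real.pi := by
      have : |a| ≠ 0 := abs_ne_zero.2 ha
      rw [abs_div, abs_div, abs_neg, abs_abs, abs_of_pos (by positivity : 0 < Real.pi * (i + 1 : ℝ))]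
      have := Real.pi_ne_zero
      push_cast
      field_simp
    rw [← Real.cos_abs, h1, Real.cos_nat_mul_pi]
  have hmono : Monotone fun i : ℕ => -|a| / (Real.pi * (i + 1 : ℝ)) := by
    intro i j hij
    have : (i : ℝ) ≤ j := by exact_mod_cast hij
    simp only [neg_div]
    refine neg_le_neg (div_le_div_of_nonneg_left (abs_nonneg a) (by positivity) ?_)
    gcongr
  have hN : ∀ N : ℕ, (N : ℝ≥0∞) ≤ eVariationOn (fun x : ℝ => Real.cos (a / x)) univ := by
    intro N
    have h1 := eVariationOn.sum_le (f := fun x : ℝ => Real.cos (a / x)) (n := N) hmono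
      (s := univ) (fun i => mem_univ _)
    refine le_trans ?_ h1
    have h2 : ∀ i ∈ Finset.range N, (1 : ℝ≥0∞) ≤
        edist (Real.cos (a / (-|a| / (Real.pi * ((i + 1 : ℕ) + 1 : ℝ)))))
          (Real.cos (a / (-|a| / (Real.pi * (i + 1 : ℝ))))) := by
      intro i _
      rw [hval, hval, edist_dist, Real.dist_eq, ENNReal.one_le_ofReal]
      have : ((-1 : ℝ) ^ (i + 1 + 1) - (-1) ^ (i + 1)) = (-1) ^ i * 2 := by ring
      rw [this, abs_mul, abs_pow, abs_neg, abs_one, one_pow]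
      norm_num
    simpa using Finset.sum_le_sum h2
  obtain ⟨N, hN'⟩ := ENNReal.exists_nat_gt h
  exact absurd (hN N) (not_le.2 hN')

/-! ### Divergence as a Henstock–Kurzweil integral -/

/-- `S` is the Riemann sum of `u` over some `γ`-fine tagged partition of `[a, b]`. -/
inductive FineSum (γ : EReal → Set EReal) (u : ℝ → ℂ) (a : EReal) : EReal → ℂ → Prop
  | nil : FineSum γ u a a 0
  | snoc {b c z : EReal} {S : ℂ} : FineSum γ u a b S → b < c → z ∈ Icc b c → Icc b c ⊆ γ z →
      FineSum γ u a c (S + if z = ⊥ ∨ z = ⊤ then 0 else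
        ((c.toReal - b.toReal : ℝ) : ℂ) * u z.toReal)

namespace FineSum

variable {γ : EReal → Set EReal} {u : ℝ → ℂ} {a b c : EReal} {S S' : ℂ}

theorem le (h : FineSum γ u a b S) : a ≤ b := by
  induction h with
  | nil => exact le_rfl
  | snoc _ h1 _ _ ih => exact ih.trans h1.le

theorem trans (h : FineSum γ u a b S) (h' : FineSum γ u b c S') : FineSum γ u a c (S + S') := by
  induction h' with
  | nil => simpa using h
  | snoc _ h1 h2 h3 ih =>
    rw [← add_assoc]
    exact ih.snoc h1 h2 h3

theorem exists_partition (h : FineSum γ u a b S) :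
    ∃ (n : ℕ) (x z : ℕ → EReal), x 0 = a ∧ x n = b ∧
      (∀ i < n, x i < x (i + 1) ∧ z i ∈ Icc (x i) (x (i + 1)) ∧
        Icc (x i) (x (i + 1)) ⊆ γ (z i)) ∧ riemannSum u n x z = S := by
  induction h with
  | nil => exact ⟨0, fun _ => a, fun _ => a, rfl, rfl, by simp, by simp [riemannSum]⟩
  | @snoc b c w S _ h1 h2 h3 ih =>
    obtain ⟨n, x, z, hx0, hxn, hf, hS⟩ := ih
    refine ⟨n + 1, fun i => if i ≤ n then x i else c, fun i => if i < n then z i else w,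
      by simpa using hx0, by simp, fun i hi => ?_, ?_⟩
    · rcases Nat.lt_succ_iff_lt_or_eq.1 hi with hi' | rfl
      · have : i + 1 ≤ n := hi'
        simpa only [if_pos hi'.le, if_pos this, if_pos hi'] using hf i hi'
      · simpa only [le_refl, if_true, lt_irrefl, if_false, hxn,
          if_neg (by lia : ¬ i + 1 ≤ i)] using ⟨h1, h2, h3⟩
    · rw [riemannSum, Finset.sum_range_succ]
      congr 1
      · rw [← hS, riemannSum]
        refine Finset.sum_congr rfl fun i hi => ?_
        have hi' := Finset.mem_range.1 hi
        have : i + 1 ≤ n := hi'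
        simp only [if_pos hi'.le, if_pos this, if_pos hi']
      · simp [hxn]

/-- Cousin's lemma. -/
theorem exists_of_gauge (u : ℝ → ℂ) (hγ : ∀ z, γ z ∈ 𝓝 z) (hab : a ≤ b) :
    ∃ S, FineSum γ u a b S := by
  -- The supremum of the reachable end points is itself reachable, with its own gauge neighbourhood
  -- as last interval, and the same neighbourhood would carry a partition beyond it unless it equals
  -- `b`.
  set s : Set EReal := {c | c ∈ Icc a b ∧ ∃ S, FineSum γ u a c S} with hs
  have has : a ∈ s := ⟨⟨le_rfl, hab⟩, 0, nil⟩
  set c := sSup s with hc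
  have hac : a ≤ c := le_sSup has
  have hcb : c ≤ b := sSup_le fun d hd => hd.1.2
  have hcs : ∃ S, FineSum γ u a c S := by
    rcases hac.eq_or_lt with h | h
    · exact h ▸ has.2
    · obtain ⟨l, hl, hlc⟩ := exists_Ioc_subset_of_mem_nhds (hγ c) ⟨a, h⟩
      obtain ⟨d, ⟨hd, S, hS⟩, hld⟩ := lt_sSup_iff.1 hl
      have hdc : d ≤ c := le_sSup ⟨hd, S, hS⟩
      rcases hdc.eq_or_lt with h' | h'
      · exact h' ▸ ⟨S, hS⟩
      · exact ⟨_, hS.snoc h' ⟨hdc, le_rfl⟩ fun y hy => hlc ⟨hld.trans_le hy.1, hy.2⟩⟩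
  rcases hcb.eq_or_lt with h | h
  · exact h ▸ hcs
  · obtain ⟨S, hS⟩ := hcs
    obtain ⟨v, hv, hvc⟩ := exists_Ico_subset_of_mem_nhds (hγ c) ⟨b, h⟩
    obtain ⟨d, hcd, hd⟩ := exists_between (lt_min hv h)
    have hds : d ∈ s := ⟨⟨hac.trans hcd.le, (hd.trans_le (min_le_right _ _)).le⟩, _,
      hS.snoc hcd ⟨le_rfl, hcd.le⟩ fun y hy =>
        hvc ⟨hy.1, hy.2.trans_lt (hd.trans_le (min_le_left _ _))⟩⟩
    exact absurd (le_sSup hds) (not_le.2 hcd)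

/-- The factor `v` is a rotation that makes the integrand point to the right. Since `y` is real, all
nodes and tags are finite and the convention at ±∞ plays no role. -/
theorem le_re {x y κ : ℝ} {v : ℂ} (hκ : ∀ t ∈ Icc x y, κ ≤ (v * u t).re)
    (h : FineSum γ u x b S) (hb : b ≤ y) : κ * (b.toReal - x) ≤ (v * S).re := by
  induction h with
  | nil => simp
  | @snoc b c z S h0 h1 h2 _ ih =>
    have hxb := h0.le
    specialize ih (h1.le.trans hb)
    lift b to ℝ using ⟨(h1.trans_le le_top).ne, ((EReal.bot_lt_coe x).trans_le hxb).ne'⟩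
    lift c to ℝ using ⟨(hb.trans_lt (EReal.coe_lt_top y)).ne, ((EReal.bot_lt_coe b).trans h1).ne'⟩
    lift z to ℝ using ⟨(h2.2.trans_lt (EReal.coe_lt_top c)).ne,
      ((EReal.bot_lt_coe b).trans_le h2.1).ne'⟩
    simp only [EReal.coe_le_coe_iff, EReal.coe_lt_coe_iff, mem_Icc] at *
    have h3 := hκ z ⟨hxb.trans h2.1, h2.2.trans hb⟩
    have h4 : (v * (S + if (z : EReal) = ⊥ ∨ (z : EReal) = ⊤ then 0 else
        (((c : EReal).toReal - (b : EReal).toReal : ℝ) : ℂ) * u (z : EReal).toReal)).re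
        = (v * S).re + (c - b) * (v * u z).re := by
      simp only [EReal.coe_ne_bot, EReal.coe_ne_top, or_self, if_false, EReal.toReal_coe]
      rw [mul_add, Complex.add_re, mul_left_comm, Complex.re_ofReal_mul]
    rw [h4]
    simp only [EReal.toReal_coe] at *
    nlinarith

end FineSum

/-- Cauchy criterion at +∞: two fine partitions of the whole line that differ only by the piece over
[b, c] have sums close to the same number, so that piece has a small sum. -/
theorem HKIntegrable.norm_lt {u : ℝ → ℂ} (hu : HKIntegrable u) {ε : ℝ} (hε : 0 < ε) :
    ∃ γ : EReal → Set EReal, (∀ z, γ z ∈ 𝓝 z) ∧ ∀ᶠ b : ℝ in atTop, ∀ c : ℝ, b ≤ c →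
      ∀ S, FineSum γ u b c S → ‖S‖ < ε := by
  obtain ⟨A, hA⟩ := hu
  obtain ⟨γ, hγ, h⟩ := hA (ε / 2) (by positivity)
  refine ⟨γ, hγ, ?_⟩
  have hsum : ∀ S, FineSum γ u ⊥ ⊤ S → ‖S - A‖ < ε / 2 := by
    intro S hS
    obtain ⟨n, x, z, h0, hn, hf, rfl⟩ := hS.exists_partition
    exact h n x z ⟨h0, hn, hf⟩
  obtain ⟨M, hM⟩ := EReal.mem_nhds_top_iff.1 (hγ ⊤)
  filter_upwards [eventually_gt_atTop M] with b hb c hbc S hS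
  -- One last interval [d, ∞] with tag `⊤` completes the partition and contributes 0.
  have htop : ∀ {d : ℝ} {T : ℂ}, b ≤ d → FineSum γ u ⊥ d T → FineSum γ u ⊥ ⊤ T := by
    intro d T hd hT
    have h1 := hT.snoc (z := ⊤) (EReal.coe_lt_top d) ⟨le_top, le_rfl⟩ fun y hy =>
      hM ((EReal.coe_lt_coe_iff.2 (hb.trans_le hd)).trans_le hy.1)
    simpa using h1
  obtain ⟨T, hT⟩ := FineSum.exists_of_gauge u hγ (bot_le (a := (b : EReal)))
  have h1 := hsum _ (htop le_rfl hT)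
  have h2 := hsum _ (htop hbc (hT.trans hS))
  have h3 : S = (T + S - A) - (T - A) := by ring
  calc ‖S‖ = ‖(T + S - A) - (T - A)‖ := by rw [← h3]
    _ ≤ ‖T + S - A‖ + ‖T - A‖ := norm_sub_le _ _
    _ < ε := by linarith

theorem not_hkIntegrable_exp_mul_cos_div (a s : ℝ) :
    ¬ HKIntegrable
      (fun t : ℝ => Complex.exp (-(Complex.I * s * t)) * ((Real.cos (a / t) : ℝ) : ℂ)) := by
  intro hu
  -- On a window of this length the phase s(b - t) stays in [-1, 1], where the cosine is at least
  -- 1/2. With cos(a/t) > 1/2 the rotated integrand is at least 1/4, so the sum is at least l/4.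
  set l : ℝ := 1 / (|s| + 1) with hl
  have hl0 : 0 < l := by positivity
  have hsl : |s| * l ≤ 1 := by
    rw [hl, mul_one_div, div_le_one (by positivity)]; linarith
  obtain ⟨γ, hγ, hb⟩ := hu.norm_lt (ε := l / 4) (by positivity)
  have hev := hb.and (eventually_forall_ge_atTop.2 ((tendsto_cos_div_atTop a).eventually
    (lt_mem_nhds (by norm_num : (1 / 2 : ℝ) < 1))))
  obtain ⟨b, hb, hcos⟩ := hev.exists
  obtain ⟨S, hS⟩ := FineSum.exists_of_gauge
    (fun t : ℝ => Complex.exp (-(Complex.I * s * t)) * ((Real.cos (a / t) : ℝ) : ℂ)) hγ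
    (EReal.coe_le_coe_iff.2 (by linarith : b ≤ b + l))
  have h1 := hb (b + l) (by linarith) S hS
  have h2 := FineSum.le_re (κ := 1 / 4) (v := Complex.exp (Complex.I * s * b)) (fun t ht => ?_) hS
    le_rfl
  · rw [EReal.toReal_coe] at h2
    have h3 : (Complex.exp (Complex.I * s * b) * S).re ≤ ‖S‖ := by
      refine (Complex.re_le_norm _).trans (le_of_eq ?_)
      have h := norm_kernel s (-b)
      rw [show -(Complex.I * s * ((-b : ℝ) : ℂ)) = Complex.I * s * b by push_cast; ring] at h
      rw [norm_mul, h, one_mul]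
    linarith
  · have h3 : (Complex.exp (Complex.I * s * b) *
        (Complex.exp (-(Complex.I * s * t)) * ((Real.cos (a / t) : ℝ) : ℂ))).re
        = Real.cos (s * (b - t)) * Real.cos (a / t) := by
      rw [← mul_assoc, ← Complex.exp_add, Complex.re_mul_ofReal,
        show Complex.I * s * b + -(Complex.I * s * t) = ((s * (b - t) : ℝ) : ℂ) * Complex.I by
          push_cast; ring, Complex.exp_ofReal_mul_I_re]
    rw [h3]
    have h4 : |s * (b - t)| ≤ 1 := by
      rw [abs_mul]
      refine le_trans (mul_le_mul_of_nonneg_left ?_ (abs_nonneg s)) hsl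
      rw [abs_le]; constructor <;> linarith [ht.1, ht.2]
    have h5 := Real.one_sub_sq_div_two_le_cos (x := s * (b - t))
    have h6 : (s * (b - t)) ^ 2 ≤ 1 := by rw [← sq_abs]; nlinarith [abs_nonneg (s * (b - t))]
    have h7 := hcos t ht.1
    nlinarith

/-! ### Divergence as a distributional integral -/

/-- The test function `t ↦ e^{ist} ψ(t)` that is paired, after translation, with
`e^{-ist} cos(a/t)`. -/
theorem exists_testFunction (a s : ℝ) :
    ∃ φ : ℝ → ℂ, ContDiff ℝ ((⊤ : ℕ∞) : WithTop ℕ∞) φ ∧ HasCompactSupport φ ∧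
      ∃ c : ℝ, 0 < c ∧ Tendsto (fun T : ℝ => ‖∫ t : ℝ, Complex.exp (-(Complex.I * s * t)) *
        ((Real.cos (a / t) : ℝ) : ℂ) * φ (t - T)‖) atTop (𝓝 c) := by
  let ψ : ContDiffBump (0 : ℝ) := default
  have hexp : ContDiff ℝ ((⊤ : ℕ∞) : WithTop ℕ∞) fun t : ℝ => Complex.exp (Complex.I * s * t) :=
    (contDiff_const.mul Complex.ofRealCLM.contDiff).cexp
  have hψ : ContDiff ℝ ((⊤ : ℕ∞) : WithTop ℕ∞) fun t : ℝ => ((ψ t : ℝ) : ℂ) :=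
    Complex.ofRealCLM.contDiff.comp ψ.contDiff
  refine ⟨fun t => Complex.exp (Complex.I * s * t) * ((ψ t : ℝ) : ℂ), hexp.mul hψ,
    (ψ.hasCompactSupport.comp_left (g := fun x : ℝ => (x : ℂ)) (by simp)).mul_left,
    ∫ t, ψ t, ψ.integral_pos, ?_⟩
  have h1 : ∀ T : ℝ, ‖∫ t : ℝ, Complex.exp (-(Complex.I * s * t)) *
        ((Real.cos (a / t) : ℝ) : ℂ) * (Complex.exp (Complex.I * s * ((t - T : ℝ) : ℂ)) *
          ((ψ (t - T) : ℝ) : ℂ))‖ = |∫ t : ℝ, Real.cos (a / (t + T)) * ψ t| := by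
    intro T
    -- The translated phase cancels the oscillation in `t` and leaves only the unimodular constant
    -- e^{-isT}.
    have h2 : ∀ t : ℝ, Complex.exp (-(Complex.I * s * t)) *
        ((Real.cos (a / t) : ℝ) : ℂ) * (Complex.exp (Complex.I * s * ((t - T : ℝ) : ℂ)) *
          ((ψ (t - T) : ℝ) : ℂ)) = Complex.exp (-(Complex.I * s * T)) *
          ((Real.cos (a / (t - T + T)) * ψ (t - T) : ℝ) : ℂ) := by
      intro t
      have : Complex.exp (-(Complex.I * s * T)) = Complex.exp (-(Complex.I * s * t)) *
          Complex.exp (Complex.I * s * ((t - T : ℝ) : ℂ)) := by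
        rw [← Complex.exp_add]; congr 1; push_cast; ring
      rw [this, sub_add_cancel, Complex.ofReal_mul]; ring
    simp_rw [h2]
    rw [integral_sub_right_eq_self (fun t : ℝ => Complex.exp (-(Complex.I * s * T)) *
          ((Real.cos (a / (t + T)) * ψ t : ℝ) : ℂ)), integral_const_mul, norm_mul, norm_kernel,
      one_mul, integral_complex_ofReal, Complex.norm_real, Real.norm_eq_abs]
  simp_rw [h1]
  have h3 : Tendsto (fun T : ℝ => ∫ t : ℝ, Real.cos (a / (t + T)) * ψ t) atTop
      (𝓝 (∫ t, ψ t)) := by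
    refine tendsto_integral_filter_of_dominated_convergence (fun t => ψ t)
      (Eventually.of_forall fun T => ?_) (Eventually.of_forall fun T => Eventually.of_forall
        fun t => ?_) ψ.integrable (Eventually.of_forall fun t => ?_)
    · exact (Measurable.aestronglyMeasurable (by fun_prop)).mul ψ.continuous.aestronglyMeasurable
    · rw [norm_mul, Real.norm_eq_abs, Real.norm_eq_abs, abs_of_nonneg (ψ.nonneg' t)]
      exact mul_le_of_le_one_left (ψ.nonneg' t) (Real.abs_cos_le_one _)
    · have := ((tendsto_cos_div_atTop a).comp
        (tendsto_atTop_add_const_left atTop t tendsto_id)).mul_const (ψ t)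
      simpa using this
  have h4 := h3.abs
  rwa [abs_of_pos ψ.integral_pos] at h4

theorem hasCompactSupport_iteratedDeriv {φ : ℝ → ℂ} (hc : HasCompactSupport φ) (n : ℕ) :
    HasCompactSupport (iteratedDeriv n φ) := by
  induction n with
  | zero => rwa [iteratedDeriv_zero]
  | succ n ih => rw [iteratedDeriv_succ]; exact ih.deriv

theorem integral_iteratedDeriv_succ_eq_zero {φ : ℝ → ℂ}
    (hφ : ContDiff ℝ ((⊤ : ℕ∞) : WithTop ℕ∞) φ) (hc : HasCompactSupport φ) (n : ℕ) :
    ∫ t, iteratedDeriv (n + 1) φ t = 0 := by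
  have hcont : ∀ m : ℕ, Continuous (iteratedDeriv m φ) := fun m =>
    hφ.continuous_iteratedDeriv m (by exact_mod_cast le_top)
  have hdiff : Differentiable ℝ (iteratedDeriv n φ) :=
    hφ.differentiable_iteratedDeriv n (by exact_mod_cast ENat.natCast_lt_top n)
  have hcs : ∀ m : ℕ, HasCompactSupport (iteratedDeriv m φ) :=
    hasCompactSupport_iteratedDeriv hc
  refine integral_eq_zero_of_hasDerivAt_of_integrable (f := iteratedDeriv n φ) (fun t => ?_)
    ((hcont _).integrable_of_hasCompactSupport (hcs _))
    ((hcont _).integrable_of_hasCompactSupport (hcs _))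
  rw [iteratedDeriv_succ]
  exact (hdiff t).hasDerivAt

/-- `e^{-ist} cos(a/t)` is not a distributional derivative of a function whose pairings with
translates of the `n`-th derivatives of test functions vanish at infinity. -/
theorem not_isDistribDeriv_of_tendsto (a s : ℝ) {n : ℕ} {F : ℝ → ℂ}
    (hF : ∀ φ : ℝ → ℂ, ContDiff ℝ ((⊤ : ℕ∞) : WithTop ℕ∞) φ → HasCompactSupport φ →
      Tendsto (fun T : ℝ => ∫ t, F t * iteratedDeriv n φ (t - T)) atTop (𝓝 0)) :
    ¬ IsDistribDeriv n F
      (fun t : ℝ => Complex.exp (-(Complex.I * s * t)) * ((Real.cos (a / t) : ℝ) : ℂ)) := by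
  intro h
  obtain ⟨φ, hφ, hc, c, hc0, hlim⟩ := exists_testFunction a s
  have h1 : ∀ T : ℝ, ∫ t : ℝ, Complex.exp (-(Complex.I * s * t)) *
        ((Real.cos (a / t) : ℝ) : ℂ) * φ (t - T) =
        (-1) ^ n * ∫ t, F t * iteratedDeriv n φ (t - T) := by
    intro T
    have := h (fun t => φ (t - T)) (hφ.comp (contDiff_id.sub contDiff_const))
      (hc.comp_homeomorph (Homeomorph.subRight T))
    rwa [iteratedDeriv_comp_sub_const] at this
  simp_rw [h1] at hlim
  have h2 := ((hF φ hφ hc).const_mul ((-1 : ℂ) ^ n)).norm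
  rw [mul_zero, norm_zero] at h2
  exact hc0.ne (tendsto_nhds_unique h2 hlim)

/-- Far out F is nearly its limit l, so the pairing tends to l ∫ φ^{(n)}, which vanishes because n ≥
1. -/
theorem not_distribIntegrable_exp_mul_cos_div (a s : ℝ) {n : ℕ} (hn : 1 ≤ n) :
    ¬ DistribIntegrable n
      (fun t : ℝ => Complex.exp (-(Complex.I * s * t)) * ((Real.cos (a / t) : ℝ) : ℂ)) := by
  rintro ⟨F, hF, -, ⟨l, hl⟩, hD⟩
  refine not_isDistribDeriv_of_tendsto a s (fun φ hφ hc => ?_) hD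
  have hcont : Continuous (iteratedDeriv n φ) :=
    hφ.continuous_iteratedDeriv n (by exact_mod_cast le_top)
  have hcs : HasCompactSupport (iteratedDeriv n φ) := hasCompactSupport_iteratedDeriv hc n
  have hint := hcont.integrable_of_hasCompactSupport (μ := volume) hcs
  have h0 : ∫ t, l * iteratedDeriv n φ t = 0 := by
    obtain ⟨m, rfl⟩ := Nat.exists_eq_add_of_le' hn
    rw [integral_const_mul, integral_iteratedDeriv_succ_eq_zero hφ hc, mul_zero]
  obtain ⟨r, hr⟩ := hcs.isCompact.isBounded.subset_closedBall 0
  have h1 : ∀ T : ℝ, ∫ t, F t * iteratedDeriv n φ (t - T) =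
      ∫ t, F (t + T) * iteratedDeriv n φ t := by
    intro T
    rw [← integral_sub_right_eq_self (fun t => F (t + T) * iteratedDeriv n φ t) T]
    simp only [sub_add_cancel]
  simp_rw [h1]
  rw [← h0]
  refine tendsto_integral_filter_of_dominated_convergence
    (fun t => (‖l‖ + 1) * ‖iteratedDeriv n φ t‖)
    (Eventually.of_forall fun T => ?_) ?_ (hint.norm.const_mul _)
    (Eventually.of_forall fun t => ?_)
  · exact Continuous.aestronglyMeasurable (by fun_prop)
  · obtain ⟨M, hM⟩ := eventually_atTop.1 (hl.norm.eventually (gt_mem_nhds (lt_add_one ‖l‖)))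
    filter_upwards [eventually_ge_atTop (M + r)] with T hT
    refine Eventually.of_forall fun t => ?_
    rw [norm_mul]
    by_cases ht : t ∈ tsupport (iteratedDeriv n φ)
    · have := hr ht
      rw [Metric.mem_closedBall, dist_zero_right, Real.norm_eq_abs] at this
      have h2 := hM (t + T) (by linarith [neg_abs_le t])
      gcongr
    · rw [image_eq_zero_of_notMem_tsupport ht]; simp
  · exact (hl.comp (tendsto_atTop_add_const_left atTop t tendsto_id)).mul_const _

/-- An elementary substitute for Hölder's inequality: on a bounded window an L^p function is
dominated by a small constant plus a multiple of its integrable p-th power. -/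
theorem le_add_mul_rpow {x ε p : ℝ} (hx : 0 ≤ x) (hε : 0 < ε) (hp : 1 ≤ p) :
    x ≤ ε + ε ^ (1 - p) * x ^ p := by
  rcases le_or_gt x ε with h | h
  · have : 0 ≤ ε ^ (1 - p) * x ^ p := by positivity
    linarith
  · have hx0 := hε.trans h
    have h1 : x ^ (1 - p) ≤ ε ^ (1 - p) :=
      Real.rpow_le_rpow_of_nonpos hε h.le (by linarith)
    have h2 : x = x ^ (1 - p) * x ^ p := by rw [← Real.rpow_add hx0]; simp
    have h3 := mul_le_mul_of_nonneg_right h1 (by positivity : 0 ≤ x ^ p)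
    linarith

theorem tendsto_setIntegral_Icc_translate {G : ℝ → ℝ} (hG : Integrable G) (r : ℝ) (hr : 0 ≤ r) :
    Tendsto (fun T : ℝ => ∫ t in Icc (T - r) (T + r), G t) atTop (𝓝 0) := by
  have h1 := (intervalIntegral_tendsto_integral_Ioi (μ := volume) 0 hG.integrableOn
    (tendsto_atTop_add_const_right atTop r tendsto_id)).sub
    (intervalIntegral_tendsto_integral_Ioi (μ := volume) 0 hG.integrableOn
    (tendsto_atTop_add_const_right atTop (-r) tendsto_id))
  rw [sub_self] at h1
  refine h1.congr fun T => ?_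
  simp only [id]
  rw [intervalIntegral.integral_interval_sub_left hG.intervalIntegrable hG.intervalIntegrable,
    intervalIntegral.integral_of_le (by linarith), integral_Icc_eq_integral_Ioc, sub_eq_add_neg]

theorem not_lpPrimitiveIntegrable_exp_mul_cos_div (a s : ℝ) {p : ℝ≥0∞} (h1 : 1 ≤ p)
    (hp : p ≠ ∞) : ¬ LpPrimitiveIntegrable p
      (fun t : ℝ => Complex.exp (-(Complex.I * s * t)) * ((Real.cos (a / t) : ℝ) : ℂ)) := by
  rintro ⟨F, hF, hD⟩
  refine not_isDistribDeriv_of_tendsto a s (fun φ hφ hc => ?_) hD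
  have hcont : Continuous (iteratedDeriv 1 φ) :=
    hφ.continuous_iteratedDeriv 1 (by exact_mod_cast le_top)
  have hcs : HasCompactSupport (iteratedDeriv 1 φ) := hasCompactSupport_iteratedDeriv hc 1
  obtain ⟨C, hC⟩ := hcs.exists_bound_of_continuous hcont
  have hC0 : 0 ≤ C := (norm_nonneg _).trans (hC 0)
  obtain ⟨r, hr0, hr⟩ := hcs.isCompact.isBounded.subset_closedBall_lt 0 0
  have hp0 : p ≠ 0 := (one_pos.trans_le h1).ne'
  have hp1 : 1 ≤ p.toReal := by simpa using ENNReal.toReal_mono hp h1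
  set G : ℝ → ℝ := fun t => ‖F t‖ ^ p.toReal with hG
  have hGi : Integrable G := hF.integrable_norm_rpow hp0 hp
  have hbound : ∀ ε : ℝ, 0 < ε → ∀ T : ℝ, ‖∫ t, F t * iteratedDeriv 1 φ (t - T)‖ ≤
      C * (2 * r * ε + ε ^ (1 - p.toReal) * ∫ t in Icc (T - r) (T + r), G t) := by
    intro ε hε T
    have h2 : ∫ t, F t * iteratedDeriv 1 φ (t - T) =
        ∫ t in Icc (T - r) (T + r), F t * iteratedDeriv 1 φ (t - T) := by
      refine (setIntegral_eq_integral_of_forall_compl_eq_zero fun t ht => ?_).symm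
      have : t - T ∉ tsupport (iteratedDeriv 1 φ) := fun h => ht (by
        have := hr h
        rw [Metric.mem_closedBall, dist_zero_right, Real.norm_eq_abs, abs_le] at this
        constructor <;> linarith [this.1, this.2])
      rw [image_eq_zero_of_notMem_tsupport this, mul_zero]
    have hvol : volume.real (Icc (T - r) (T + r)) = 2 * r := by
      rw [Measure.real, Real.volume_Icc, ENNReal.toReal_ofReal (by linarith)]; ring
    have hconst : IntegrableOn (fun _ : ℝ => ε) (Icc (T - r) (T + r)) :=
      integrableOn_const (by simp)
    rw [h2]
    calc ‖∫ t in Icc (T - r) (T + r), F t * iteratedDeriv 1 φ (t - T)‖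
        ≤ ∫ t in Icc (T - r) (T + r), C * (ε + ε ^ (1 - p.toReal) * G t) := by
          refine norm_integral_le_of_norm_le
            ((hconst.add (hGi.integrableOn.const_mul _)).const_mul C)
            (Eventually.of_forall fun t => ?_)
          rw [norm_mul, mul_comm]
          exact mul_le_mul (hC _) (le_add_mul_rpow (norm_nonneg _) hε hp1) (norm_nonneg _) hC0
      _ = _ := by
          rw [integral_const_mul, integral_add hconst (hGi.integrableOn.const_mul _),
            integral_const_mul, setIntegral_const, hvol, smul_eq_mul]
  rw [Metric.tendsto_nhds]
  intro δ hδ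
  -- With this ε the constant part contributes 2rCε = Cδ / (2(C + 1)) < δ; the other part tends to 0
  -- as the window moves away.
  have hε : 0 < δ / (2 * (C + 1) * (2 * r)) := by positivity
  set ε := δ / (2 * (C + 1) * (2 * r)) with hεd
  have hlim := (((tendsto_setIntegral_Icc_translate hGi r hr0.le).const_mul
    (ε ^ (1 - p.toReal))).const_add (2 * r * ε)).const_mul C
  have hlt : C * (2 * r * ε + ε ^ (1 - p.toReal) * 0) < δ := by
    have h3 : 2 * r * ε = δ / (2 * (C + 1)) := by rw [hεd]; field_simp
    rw [mul_zero, add_zero, h3, mul_div_assoc', div_lt_iff₀ (by positivity)]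
    nlinarith
  filter_upwards [hlim.eventually (gt_mem_nhds hlt)] with T hT
  rw [dist_zero_right]
  exact (hbound ε hε T).trans_lt hT

/-! ### The Bessel functions as entire series: derivative, recurrence, bound -/

/-- The entire function `E_n` with `J_n(2√w) = w^{n/2} E_n(w)`. -/
def besselSeries (n : ℕ) (w : ℝ) : ℝ :=
  ∑' k : ℕ, (-1 : ℝ) ^ k / (k.factorial * (k + n).factorial) * w ^ k

theorem abs_besselSeries_coeff_le (n k : ℕ) :
    |(-1 : ℝ) ^ k / (k.factorial * (k + n).factorial)| ≤ 1 / k.factorial := by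
  have h1 : (1 : ℝ) ≤ ((k + n).factorial : ℝ) := by
    exact_mod_cast Nat.succ_le_of_lt (Nat.factorial_pos _)
  have h2 : (0 : ℝ) < (k.factorial : ℝ) := by exact_mod_cast Nat.factorial_pos _
  rw [abs_div, abs_pow, abs_neg, abs_one, one_pow, abs_of_pos (by positivity)]
  exact one_div_le_one_div_of_le h2 (le_mul_of_one_le_right h2.le h1)

theorem summable_besselSeries (n : ℕ) (w : ℝ) :
    Summable fun k : ℕ => (-1 : ℝ) ^ k / (k.factorial * (k + n).factorial) * w ^ k := by
  refine Summable.of_norm_bounded (Real.summable_pow_div_factorial |w|) fun k => ?_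
  rw [norm_mul, Real.norm_eq_abs, norm_pow, Real.norm_eq_abs, div_eq_mul_one_div (|w| ^ k),
    mul_comm]
  exact mul_le_mul_of_nonneg_left (abs_besselSeries_coeff_le n k) (by positivity)

theorem hasDerivAt_besselSeries (n : ℕ) (w : ℝ) :
    HasDerivAt (besselSeries n) (-besselSeries (n + 1) w) w := by
  set R : ℝ := |w| + 1
  have hR : 0 ≤ R := by positivity
  -- A summable majorant of the differentiated terms on the ball of radius |w| + 1; shifted by one
  -- index it is the exponential series.
  set u : ℕ → ℝ := fun k => k * R ^ (k - 1) / k.factorial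
  have hshift : ∀ k : ℕ, u (k + 1) = R ^ k / k.factorial := by
    intro k
    have h2 : (k.factorial : ℝ) ≠ 0 := by positivity
    have h3 : (k + 1 : ℝ) ≠ 0 := by positivity
    simp only [u, Nat.factorial_succ, Nat.add_sub_cancel]
    push_cast
    field_simp
  have hu : Summable u := by
    rw [← summable_nat_add_iff 1]
    simp_rw [hshift]
    exact Real.summable_pow_div_factorial R
  have hmem : w ∈ Metric.ball (0 : ℝ) R := by
    rw [Metric.mem_ball, dist_zero_right, Real.norm_eq_abs]; exact lt_add_one _
  have h := hasDerivAt_tsum_of_isPreconnected (𝕜 := ℝ) (F := ℝ)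
    (g := fun (k : ℕ) (y : ℝ) => (-1 : ℝ) ^ k / (k.factorial * (k + n).factorial) * y ^ k)
    (g' := fun (k : ℕ) (y : ℝ) =>
      (-1 : ℝ) ^ k / (k.factorial * (k + n).factorial) * (k * y ^ (k - 1)))
    hu Metric.isOpen_ball (convex_ball (0 : ℝ) R).isPreconnected
    (fun k y _ => (hasDerivAt_pow k y).const_mul _) (fun k y hy => ?_) hmem
    (summable_besselSeries n w) hmem
  · refine HasDerivAt.congr_deriv (f := besselSeries n) h ?_
    rw [Summable.tsum_eq_zero_add]
    · simp only [besselSeries, CharP.cast_eq_zero, zero_mul, mul_zero, zero_add, ← tsum_neg]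
      refine tsum_congr fun k => ?_
      have h2 : (k.factorial : ℝ) ≠ 0 := by positivity
      have h3 : (k + 1 : ℝ) ≠ 0 := by positivity
      have h4 : ((k + (n + 1)).factorial : ℝ) ≠ 0 := by positivity
      rw [show k + 1 + n = k + (n + 1) by ring, Nat.factorial_succ k, Nat.add_sub_cancel]
      push_cast
      field_simp
      ring
    · refine Summable.of_norm_bounded hu fun k => ?_
      rw [Metric.mem_ball, dist_zero_right, Real.norm_eq_abs] at hmem
      rw [norm_mul, Real.norm_eq_abs, norm_mul, norm_pow, Real.norm_eq_abs, Real.norm_eq_abs,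
        Nat.abs_cast]
      calc _ ≤ 1 / (k.factorial : ℝ) * (k * R ^ (k - 1)) := by
            gcongr
            exact abs_besselSeries_coeff_le n k
        _ = u k := by simp only [u]; ring
  · rw [Metric.mem_ball, dist_zero_right, Real.norm_eq_abs] at hy
    rw [norm_mul, Real.norm_eq_abs, norm_mul, norm_pow, Real.norm_eq_abs, Real.norm_eq_abs,
        Nat.abs_cast]
    calc _ ≤ 1 / (k.factorial : ℝ) * (k * R ^ (k - 1)) := by
          gcongr
          exact abs_besselSeries_coeff_le n k
      _ = u k := by simp only [u]; ring

theorem continuous_besselSeries (n : ℕ) : Continuous (besselSeries n) :=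
  continuous_iff_continuousAt.2 fun w => (hasDerivAt_besselSeries n w).continuousAt

theorem besselSeries_zero_right (n : ℕ) : besselSeries n 0 = 1 / n.factorial := by
  rw [besselSeries, tsum_eq_single 0 (fun k hk => by simp [hk])]
  simp

/-- Coefficientwise this is (n + 1 + k) / (k + n + 1)! = 1 / (k + n)!. Together with E_{n+1}' =
-E_{n+2} it says that w^{n+1} E_{n+1} has derivative w^n E_n. -/
theorem besselSeries_recurrence (n : ℕ) (w : ℝ) :
    (n + 1) * besselSeries (n + 1) w - w * besselSeries (n + 2) w = besselSeries n w := by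
  have h1 : w * besselSeries (n + 2) w = ∑' k : ℕ, (-1 : ℝ) ^ (k + 1) * (-(k + 1 : ℝ)) /
      ((k + 1).factorial * (k + 1 + (n + 1)).factorial) * w ^ (k + 1) := by
    rw [besselSeries, ← tsum_mul_left]
    refine tsum_congr fun k => ?_
    have h2 : (k.factorial : ℝ) ≠ 0 := by positivity
    have h3 : (k + 1 : ℝ) ≠ 0 := by positivity
    have h4 : ((k + (n + 2)).factorial : ℝ) ≠ 0 := by positivity
    rw [show k + 1 + (n + 1) = k + (n + 2) by ring, Nat.factorial_succ k]
    push_cast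
    field_simp
    ring
  have h5 : besselSeries (n + 1) w = _ := (summable_besselSeries (n + 1) w).tsum_eq_zero_add
  have h6 : besselSeries n w = _ := (summable_besselSeries n w).tsum_eq_zero_add
  have h7 := (summable_nat_add_iff 1).2 (summable_besselSeries (n + 1) w)
  have h8 : Summable fun k : ℕ => (-1 : ℝ) ^ (k + 1) * (-(k + 1 : ℝ)) /
      ((k + 1).factorial * (k + 1 + (n + 1)).factorial) * w ^ (k + 1) := by
    refine ((summable_besselSeries (n + 2) w).mul_left w).congr fun k => ?_
    have h2 : (k.factorial : ℝ) ≠ 0 := by positivity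
    have h3 : (k + 1 : ℝ) ≠ 0 := by positivity
    have h4 : ((k + (n + 2)).factorial : ℝ) ≠ 0 := by positivity
    rw [show k + 1 + (n + 1) = k + (n + 2) by ring, Nat.factorial_succ k]
    push_cast
    field_simp
    ring
  rw [h1, h5, h6, mul_add, ← tsum_mul_left, add_sub_assoc, ← (h7.mul_left _).tsum_sub h8]
  congr 1
  · rw [zero_add, zero_add, Nat.factorial_succ n]
    have h2 : (n.factorial : ℝ) ≠ 0 := by positivity
    have h3 : (n + 1 : ℝ) ≠ 0 := by positivity
    push_cast
    field_simp
  · refine tsum_congr fun k => ?_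
    have h2 : ((k + 1).factorial : ℝ) ≠ 0 := by positivity
    have h3 : (k + 1 + n + 1 : ℝ) ≠ 0 := by positivity
    have h4 : ((k + 1 + n).factorial : ℝ) ≠ 0 := by positivity
    rw [show k + 1 + (n + 1) = (k + 1 + n) + 1 by ring, Nat.factorial_succ (k + 1 + n)]
    push_cast
    field_simp
    ring

/-- For n = 0 the energy E_0² + w E_1², which is J_0² + J_1² at 2√w, has derivative -E_1² and starts
at 1. The inductive step integrates (w^{n+1} E_{n+1})' = w^n E_n and compares with w^{n+1}, whose
derivative is (n + 1) w^n. This bound, uniform on the half-line, supplies the later majorants. -/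
theorem abs_besselSeries_le_one (n : ℕ) : ∀ w : ℝ, 0 ≤ w → |besselSeries n w| ≤ 1 := by
  induction n with
  | zero =>
    intro w hw
    have hd : ∀ x : ℝ, HasDerivAt (fun x => besselSeries 0 x ^ 2 + x * besselSeries 1 x ^ 2)
        (-besselSeries 1 x ^ 2) x := by
      intro x
      have h := ((hasDerivAt_besselSeries 0 x).pow 2).add
        ((hasDerivAt_id x).mul ((hasDerivAt_besselSeries 1 x).pow 2))
      refine h.congr_deriv ?_
      have hr := besselSeries_recurrence 0 x
      simp only [Pi.pow_apply, id, Nat.cast_zero, zero_add, one_mul] at hr ⊢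
      norm_num
      linear_combination (2 * besselSeries 1 x) * hr
    have hanti := antitone_of_deriv_nonpos
      (f := fun x => besselSeries 0 x ^ 2 + x * besselSeries 1 x ^ 2)
      (fun x => (hd x).differentiableAt) (fun x => by rw [(hd x).deriv]; nlinarith)
    have h := hanti hw
    simp only [besselSeries_zero_right, Nat.factorial_zero, zero_mul, add_zero] at h
    rw [← sq_le_one_iff_abs_le_one]
    have : 0 ≤ w * besselSeries 1 w ^ 2 := by positivity
    norm_num at h
    linarith
  | succ n ih =>
    intro w hw
    have hd : ∀ x : ℝ, HasDerivAt (fun x => x ^ (n + 1) * besselSeries (n + 1) x)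
        (x ^ n * besselSeries n x) x := by
      intro x
      have h := (hasDerivAt_pow (n + 1) x).mul (hasDerivAt_besselSeries (n + 1) x)
      refine h.congr_deriv ?_
      have hr := besselSeries_recurrence n x
      simp only [Nat.add_sub_cancel]
      push_cast
      rw [← hr]
      ring
    have hp : ∀ x : ℝ, HasDerivAt (fun x : ℝ => x ^ (n + 1)) ((n + 1) * x ^ n) x := by
      intro x
      simpa using hasDerivAt_pow (n + 1) x
    -- The two signs σ = ±1 give the upper and the lower bound by one monotonicity argument.
    have key : ∀ σ : ℝ, |σ| = 1 → 0 ≤ w ^ (n + 1) - σ * (w ^ (n + 1) * besselSeries (n + 1) w) := by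
      intro σ hσ
      have hd' := fun x => (hp x).sub ((hd x).const_mul σ)
      have hmono := monotoneOn_of_deriv_nonneg (convex_Ici (0 : ℝ))
        (f := fun x => x ^ (n + 1) - σ * (x ^ (n + 1) * besselSeries (n + 1) x))
        (fun x _ => (hd' x).continuousAt.continuousWithinAt)
        (fun x _ => (hd' x).differentiableAt.differentiableWithinAt) (fun x hx => by
          rw [interior_Ici, mem_Ioi] at hx
          have e := (hd' x).deriv
          have h1 : σ * besselSeries n x ≤ 1 := by
            refine (le_abs_self _).trans ?_
            rw [abs_mul, hσ, one_mul]; exact ih x hx.le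
          have h2 : 0 < x ^ n := by positivity
          have h3 : (0 : ℝ) ≤ n := by positivity
          have h4 : (0 : ℝ) ≤ (n + 1) * x ^ n - σ * (x ^ n * besselSeries n x) := by nlinarith
          rw [← e] at h4
          exact h4)
      simpa using hmono (mem_Ici.2 le_rfl) (mem_Ici.2 hw) hw
    rcases hw.eq_or_lt with rfl | hw
    · rw [besselSeries_zero_right, abs_of_nonneg (by positivity)]
      refine div_le_one_of_le₀ ?_ (by positivity)
      exact_mod_cast Nat.succ_le_of_lt (Nat.factorial_pos _)
    · have h1 := key 1 (by simp)
      have h2 := key (-1) (by simp)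
      have h3 : 0 < w ^ (n + 1) := by positivity
      rw [abs_le]
      constructor
      · by_contra! h; nlinarith
      · by_contra! h; nlinarith

theorem besselJ_two_mul_sqrt (n : ℕ) {w : ℝ} (hw : 0 ≤ w) :
    besselJ n (2 * √w) = √w ^ n * besselSeries n w := by
  rw [besselJ, besselSeries, ← tsum_mul_left]
  refine tsum_congr fun k => ?_
  rw [mul_div_cancel_left₀ _ two_ne_zero, pow_add, pow_mul, Real.sq_sqrt hw]
  ring

/-! ### The Laplace transform of the Bessel kernel -/

theorem integrableOn_pow_mul_exp_neg (k : ℕ) {ε : ℝ} (hε : 0 < ε) :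
    IntegrableOn (fun s : ℝ => s ^ k * Real.exp (-(ε * s))) (Ioi 0) := by
  have h := integrableOn_rpow_mul_exp_neg_mul_rpow (p := 1) (s := k) (b := ε)
    (by linarith [(Nat.cast_nonneg k : (0 : ℝ) ≤ k)]) one_pos hε
  simpa using h

theorem integral_pow_mul_exp_neg (k : ℕ) {ε : ℝ} (hε : 0 < ε) :
    ∫ s in Ioi (0 : ℝ), s ^ k * Real.exp (-(ε * s)) = k.factorial / ε ^ (k + 1) := by
  have h := Real.integral_rpow_mul_exp_neg_mul_Ioi (a := k + 1) (r := ε) (by positivity) hε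
  rw [Real.Gamma_nat_eq_factorial, add_sub_cancel_right] at h
  simp only [Real.rpow_natCast] at h
  rw [h, ← Nat.cast_succ, Real.rpow_natCast, one_div, inv_pow, div_eq_inv_mul]

theorem norm_exp_neg_mul_ofReal (p : ℂ) (s : ℝ) :
    ‖Complex.exp (-(p * s))‖ = Real.exp (-(p.re * s)) := by
  rw [Complex.norm_exp, Complex.neg_re, Complex.re_mul_ofReal]

theorem integrableOn_pow_mul_cexp_neg (k : ℕ) {p : ℂ} (hp : 0 < p.re) :
    IntegrableOn (fun s : ℝ => (s : ℂ) ^ k * Complex.exp (-(p * s))) (Ioi 0) := by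
  refine (integrableOn_pow_mul_exp_neg k hp).mono'
    (Continuous.aestronglyMeasurable (by fun_prop)) ?_
  refine (ae_restrict_iff' measurableSet_Ioi).2 (Eventually.of_forall fun s hs => ?_)
  rw [norm_mul, norm_exp_neg_mul_ofReal, norm_pow, Complex.norm_real, Real.norm_eq_abs,
    abs_of_pos hs]

theorem tendsto_pow_mul_cexp_neg (k : ℕ) {p : ℂ} (hp : 0 < p.re) :
    Tendsto (fun s : ℝ => (s : ℂ) ^ k * Complex.exp (-(p * s))) atTop (𝓝 0) := by
  rw [tendsto_zero_iff_norm_tendsto_zero]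
  have h := tendsto_rpow_mul_exp_neg_mul_atTop_nhds_zero k p.re hp
  refine h.congr' ?_
  filter_upwards [eventually_gt_atTop 0] with s hs
  rw [norm_mul, norm_exp_neg_mul_ofReal, norm_pow, Complex.norm_real, Real.norm_eq_abs,
    abs_of_pos hs, Real.rpow_natCast, neg_mul]

theorem hasDerivAt_cexp_neg_mul (p : ℂ) (s : ℝ) :
    HasDerivAt (fun s : ℝ => Complex.exp (-(p * s))) (-p * Complex.exp (-(p * s))) s := by
  have h := ((Complex.ofRealCLM.hasDerivAt (x := s)).const_mul p).neg.cexp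
  refine h.congr_deriv ?_
  simp only [Complex.ofRealCLM_apply, Pi.neg_apply]
  push_cast
  ring

/-- Induction on k: integrating the derivative of s^{k+1} e^{-ps} over the half-line gives p I_{k+1}
= (k + 1) I_k. -/
theorem integral_pow_mul_cexp_neg (k : ℕ) {p : ℂ} (hp : 0 < p.re) :
    ∫ s in Ioi (0 : ℝ), (s : ℂ) ^ k * Complex.exp (-(p * s)) = k.factorial / p ^ (k + 1) := by
  have hp0 : p ≠ 0 := fun h => by simp [h] at hp
  induction k with
  | zero =>
    have h := integral_Ioi_of_hasDerivAt_of_tendsto' (a := 0) (fun s _ => hasDerivAt_cexp_neg_mul p s)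
      (by simpa [IntegrableOn] using (integrableOn_pow_mul_cexp_neg 0 hp).const_mul (-p))
      (by simpa using tendsto_pow_mul_cexp_neg 0 hp)
    rw [integral_const_mul] at h
    simp only [pow_zero, one_mul, zero_add, pow_one, Nat.factorial_zero, Nat.cast_one]
    rw [eq_div_iff hp0]
    simp only [Complex.ofReal_zero, mul_zero, neg_zero, Complex.exp_zero] at h
    linear_combination -h
  | succ k ih =>
    have hd : ∀ s : ℝ, HasDerivAt (fun s : ℝ => (s : ℂ) ^ (k + 1) * Complex.exp (-(p * s)))
        ((k + 1) * ((s : ℂ) ^ k * Complex.exp (-(p * s))) +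
          -p * ((s : ℂ) ^ (k + 1) * Complex.exp (-(p * s)))) s := by
      intro s
      have h := ((Complex.ofRealCLM.hasDerivAt (x := s)).pow (k + 1)).mul
        (hasDerivAt_cexp_neg_mul p s)
      refine h.congr_deriv ?_
      simp only [Complex.ofRealCLM_apply, Nat.add_sub_cancel, Pi.pow_apply]
      push_cast
      ring
    have h1 := (integrableOn_pow_mul_cexp_neg k hp).const_mul (k + 1 : ℂ)
    have h2 := (integrableOn_pow_mul_cexp_neg (k + 1) hp).const_mul (-p)
    have h := integral_Ioi_of_hasDerivAt_of_tendsto' (a := 0) (fun s _ => hd s) (h1.add h2)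
      (tendsto_pow_mul_cexp_neg (k + 1) hp)
    rw [integral_add h1 h2, integral_const_mul, integral_const_mul, ih] at h
    simp only [Complex.ofReal_zero, ne_eq, Nat.add_eq_zero_iff, one_ne_zero, and_false,
      not_false_eq_true, zero_pow, zero_mul, sub_zero] at h
    rw [Nat.factorial_succ]
    push_cast
    have h3 : p * ∫ s in Ioi (0 : ℝ), (s : ℂ) ^ (k + 1) * Complex.exp (-(p * s)) =
        (k + 1) * (k.factorial / p ^ (k + 1)) := by linear_combination -h
    rw [← mul_right_inj' hp0, h3]
    field_simp
    ring

/-- Termwise, k!/p^{k+1} cancels one of the two factorials in the Bessel coefficients and leaves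
minus the exponential series of -a/p without its constant term. The exchange is justified by the
exponential series of a / Re p. -/
theorem integral_besselSeries_mul_cexp_neg {a : ℝ} (ha : 0 < a) {p : ℂ} (hp : 0 < p.re) :
    ∫ s in Ioi (0 : ℝ), ((a * besselSeries 1 (a * s) : ℝ) : ℂ) * Complex.exp (-(p * s)) =
      1 - Complex.exp (-(a / p)) := by
  set c : ℕ → ℝ := fun k => a ^ (k + 1) * ((-1) ^ k / (k.factorial * (k + 1).factorial))
  set F : ℕ → ℝ → ℂ := fun k s => (c k : ℂ) * ((s : ℂ) ^ k * Complex.exp (-(p * s)))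
  have hp0 : p ≠ 0 := fun h => by simp [h] at hp
  have hF : ∀ k, IntegrableOn (F k) (Ioi 0) := fun k =>
    (integrableOn_pow_mul_cexp_neg k hp).const_mul _
  have hnorm : ∀ k, ∫ s in Ioi (0 : ℝ), ‖F k s‖ = (a / p.re) ^ (k + 1) / (k + 1).factorial := by
    intro k
    have h1 : ∀ s ∈ Ioi (0 : ℝ), ‖F k s‖ = |c k| * (s ^ k * Real.exp (-(p.re * s))) := by
      intro s hs
      simp only [F]
      rw [norm_mul, norm_mul, norm_exp_neg_mul_ofReal, norm_pow, Complex.norm_real,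
        Complex.norm_real, Real.norm_eq_abs, Real.norm_eq_abs, abs_of_pos (a := s) hs]
    rw [setIntegral_congr_fun measurableSet_Ioi h1, integral_const_mul,
      integral_pow_mul_exp_neg k hp]
    simp only [c]
    rw [abs_mul, abs_div, abs_pow, abs_pow, abs_neg, abs_one, one_pow, abs_of_pos ha,
      abs_of_pos (by positivity : (0 : ℝ) < k.factorial * (k + 1).factorial)]
    have h2 : (k.factorial : ℝ) ≠ 0 := by positivity
    have h3 := hp.ne'
    rw [div_pow]
    field_simp
  have hsum : Summable fun k => ∫ s in Ioi (0 : ℝ), ‖F k s‖ := by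
    simp_rw [hnorm]
    exact (summable_nat_add_iff 1).2 (Real.summable_pow_div_factorial (a / p.re))
  have h := hasSum_integral_of_summable_integral_norm hF hsum
  have h1 : ∀ s : ℝ, ∑' k, F k s =
      ((a * besselSeries 1 (a * s) : ℝ) : ℂ) * Complex.exp (-(p * s)) := by
    intro s
    simp only [F, ← mul_assoc]
    rw [tsum_mul_right, besselSeries, ← tsum_mul_left, Complex.ofReal_tsum]
    congr 1
    refine tsum_congr fun k => ?_
    simp only [c]
    push_cast
    ring
  simp_rw [h1] at h
  have h2 : ∀ k, ∫ s in Ioi (0 : ℝ), F k s = -((-(a / p)) ^ (k + 1) / (k + 1).factorial) := by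
    intro k
    simp only [F]
    rw [integral_const_mul, integral_pow_mul_cexp_neg k hp]
    simp only [c]
    have h2 : (k.factorial : ℂ) ≠ 0 := by exact_mod_cast Nat.factorial_ne_zero k
    have h3 : ((k + 1).factorial : ℂ) ≠ 0 := by exact_mod_cast Nat.factorial_ne_zero (k + 1)
    push_cast
    rw [← neg_div (p : ℂ) (a : ℂ), div_pow (-(a : ℂ)) p, neg_pow (a : ℂ) (k + 1)]
    field_simp
    ring
  simp_rw [h2] at h
  have h3 := NormedSpace.expSeries_div_hasSum_exp (-(a / p) : ℂ)
  rw [← Complex.exp_eq_exp_ℂ] at h3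
  have h4 := ((hasSum_nat_add_iff' 1).2 h3).neg
  rw [h.unique h4]
  simp

/-! ### The classical Fourier transform with kernel `e^{-ist}` -/

/-- `t ↦ ∫ e^{-ist} φ(s) ds`. -/
def hat (φ : ℝ → ℂ) (t : ℝ) : ℂ :=
  ∫ s : ℝ, Complex.exp (-(Complex.I * s * t)) * φ s

open FourierTransform in
-- A rescaling by 2π links the kernel e^{-ist} to the normalisation e^{-2πist}, so that inversion
-- and the rule for derivatives carry over.
theorem hat_eq_fourier (φ : ℝ → ℂ) (t : ℝ) : hat φ t = 𝓕 φ (t / (2 * Real.pi)) := by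
  rw [Real.fourier_real_eq_integral_exp_smul, hat]
  refine integral_congr_ae (Eventually.of_forall fun s => ?_)
  simp only [smul_eq_mul]
  congr 2
  have : (Real.pi : ℂ) ≠ 0 := by exact_mod_cast Real.pi_ne_zero
  push_cast
  field_simp

open FourierTransform in
theorem integrable_hat (φ : 𝓢(ℝ, ℂ)) : Integrable (hat φ) := by
  have h := (𝓕 φ).integrable (μ := volume).comp_div (R := 2 * Real.pi) (by positivity)
  refine h.congr (Eventually.of_forall fun t => ?_)
  simp only [hat_eq_fourier, SchwartzMap.fourier_coe]

open FourierTransform in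
theorem integral_exp_mul_hat (φ : 𝓢(ℝ, ℂ)) (s : ℝ) :
    ∫ t : ℝ, Complex.exp (Complex.I * s * t) * hat φ t = 2 * Real.pi * φ s := by
  have h : 𝓕⁻ (𝓕 (φ : ℝ → ℂ)) s = φ s := by
    rw [φ.continuous.fourierInv_fourier_eq φ.integrable (𝓕 φ).integrable]
  rw [Real.fourierInv_eq'] at h
  have h1 := Measure.integral_comp_div (fun v : ℝ =>
    Complex.exp (((2 * Real.pi * inner ℝ v s : ℝ) : ℂ) * Complex.I) • 𝓕 (φ : ℝ → ℂ) v)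
    (2 * Real.pi)
  rw [h, abs_of_pos (by positivity)] at h1
  rw [Complex.real_smul] at h1
  push_cast at h1
  rw [← h1]
  refine integral_congr_ae (Eventually.of_forall fun t => ?_)
  simp only [hat_eq_fourier, smul_eq_mul]
  congr 2
  have : (Real.pi : ℂ) ≠ 0 := by exact_mod_cast Real.pi_ne_zero
  simp only [RCLike.inner_apply, conj_trivial]
  push_cast
  field_simp

open FourierTransform in
theorem hat_deriv (φ : 𝓢(ℝ, ℂ)) (t : ℝ) : hat (deriv φ) t = Complex.I * t * hat φ t := by
  have h := Real.fourier_deriv φ.integrable φ.differentiable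
    ((SchwartzMap.derivCLM ℂ ℂ φ).integrable (μ := volume))
  rw [hat_eq_fourier, hat_eq_fourier, h]
  simp only [smul_eq_mul]
  have : (Real.pi : ℂ) ≠ 0 := by exact_mod_cast Real.pi_ne_zero
  push_cast
  field_simp

theorem hat_reflect (φ : ℝ → ℂ) (t : ℝ) : hat (fun s => φ (-s)) t = hat φ (-t) := by
  rw [hat, hat, ← integral_neg_eq_self]
  refine integral_congr_ae (Eventually.of_forall fun s => ?_)
  simp

/-- Fubini's theorem for a product of integrable functions and a bounded continuous kernel. -/
theorem integrable_kernel_mul {μ ν : Measure ℝ} [SFinite μ] [SFinite ν] {k : ℝ → ℝ → ℂ}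
    (hk : Continuous (Function.uncurry k)) (hb : ∀ s t, ‖k s t‖ ≤ 1) {G φ : ℝ → ℂ}
    (hG : Integrable G μ) (hφ : Integrable φ ν) :
    Integrable (fun z : ℝ × ℝ => k z.1 z.2 * G z.2 * φ z.1) (ν.prod μ) := by
  have h := (hφ.mul_prod hG).bdd_mul (c := 1) (f := Function.uncurry k) hk.aestronglyMeasurable
    (Eventually.of_forall fun z => hb z.1 z.2)
  refine h.congr (Eventually.of_forall fun z => ?_)
  simp only [Function.uncurry]
  ring

theorem integral_kernel_swap {μ ν : Measure ℝ} [SFinite μ] [SFinite ν] {k : ℝ → ℝ → ℂ}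
    (hk : Continuous (Function.uncurry k)) (hb : ∀ s t, ‖k s t‖ ≤ 1) {G φ : ℝ → ℂ}
    (hG : Integrable G μ) (hφ : Integrable φ ν) :
    ∫ s, (∫ t, k s t * G t ∂μ) * φ s ∂ν = ∫ t, G t * (∫ s, k s t * φ s ∂ν) ∂μ := by
  have h := integral_integral_swap (f := fun s t => k s t * G t * φ s)
    (integrable_kernel_mul hk hb hG hφ)
  simp_rw [← integral_mul_const, ← integral_const_mul]
  rw [h]
  refine integral_congr_ae (Eventually.of_forall fun t => ?_)
  refine integral_congr_ae (Eventually.of_forall fun s => ?_)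
  simp only []
  ring

theorem integrable_kernel_transform_mul {μ ν : Measure ℝ} [SFinite μ] [SFinite ν] {k : ℝ → ℝ → ℂ}
    (hk : Continuous (Function.uncurry k)) (hb : ∀ s t, ‖k s t‖ ≤ 1) {G φ : ℝ → ℂ}
    (hG : Integrable G μ) (hφ : Integrable φ ν) :
    Integrable (fun s => (∫ t, k s t * G t ∂μ) * φ s) ν := by
  have h := (integrable_kernel_mul hk hb hG hφ).integral_prod_left
  refine h.congr (Eventually.of_forall fun s => ?_)
  simp only [integral_mul_const]

theorem continuous_exp_kernel :
    Continuous (Function.uncurry fun s t : ℝ => Complex.exp (-(Complex.I * s * t))) := by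
  simp only [Function.uncurry_def]
  fun_prop

theorem measurableSet_one_lt_abs : MeasurableSet {t : ℝ | 1 < |t|} :=
  measurableSet_lt measurable_const measurable_abs

/-- The distributional transform is characterised by the multiplication formula. -/
theorem fourier_apply_eq_integral_hat (f : ℝ → ℂ) (hf : MemLp f ∞ volume) (φ : 𝓢(ℝ, ℂ)) :
    fourier f hf φ = ∫ t, f t * hat φ t := by
  have hfi : Integrable (fun t => f t * hat φ t) :=
    Integrable.mul_of_top_right (integrable_hat φ) hf
  have hφ2 : Integrable (deriv (deriv φ)) :=
    (SchwartzMap.derivCLM ℂ ℂ (SchwartzMap.derivCLM ℂ ℂ φ)).integrable (μ := volume)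
  -- The factor -t² cancels both the weight 1/t² in `Psi` and the minus sign in front of its second
  -- derivative.
  have h2 : ∀ t, hat (deriv (deriv φ)) t = -(t : ℂ) ^ 2 * hat φ t := by
    intro t
    have := hat_deriv (SchwartzMap.derivCLM ℂ ℂ φ) t
    have e : (SchwartzMap.derivCLM ℂ ℂ φ : ℝ → ℂ) = deriv φ := rfl
    rw [e, hat_deriv] at this
    rw [this]
    linear_combination (t : ℂ) ^ 2 * hat φ t * Complex.I_sq
  have hin : ∫ s, innerTransform f s * φ s = ∫ t in Icc (-1 : ℝ) 1, f t * hat φ t := by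
    simp only [innerTransform, hat]
    exact integral_kernel_swap continuous_exp_kernel (fun s t => (norm_kernel s t).le)
      ((hf.restrict (Icc (-1 : ℝ) 1)).integrable le_top) φ.integrable
  have hb : IntegrableOn (fun t : ℝ => f t / (t : ℂ) ^ 2) {t : ℝ | 1 < |t|} := by
    have hb : IntegrableOn (fun t : ℝ => ((t : ℂ) ^ 2)⁻¹) {t : ℝ | 1 < |t|} := by
      refine Integrable.mono' ((integrable_inv_one_add_sq.const_mul 2).integrableOn)
        (Measurable.aestronglyMeasurable (by fun_prop)) ?_
      refine (ae_restrict_iff' measurableSet_one_lt_abs).2 (Eventually.of_forall fun t ht => ?_)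
      have h1 : 1 < t ^ 2 := by
        have : (1 : ℝ) < |t| := ht
        nlinarith [sq_abs t]
      rw [norm_inv, norm_pow, Complex.norm_real, Real.norm_eq_abs, sq_abs, ← div_eq_mul_inv,
        inv_eq_one_div, div_le_div_iff₀ (by linarith) (by linarith)]
      linarith
    simp only [div_eq_mul_inv]
    exact Integrable.mul_of_top_right hb (hf.restrict _)
  have hout : ∫ s, Psi f s * deriv (deriv φ) s = -∫ t in {t : ℝ | 1 < |t|}, f t * hat φ t := by
    have h := integral_kernel_swap continuous_exp_kernel (fun s t => (norm_kernel s t).le)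
      hb hφ2
    simp only [mul_div_assoc'] at h
    have e : ∀ s, Psi f s = ∫ t in {t : ℝ | 1 < |t|},
      Complex.exp (-(Complex.I * s * t)) * f t / (t : ℂ) ^ 2 := fun s => rfl
    simp_rw [e]
    rw [h, ← integral_neg]
    refine setIntegral_congr_fun measurableSet_one_lt_abs fun t ht => ?_
    have ht0 : (t : ℂ) ≠ 0 := by
      rintro h0
      rw [Complex.ofReal_eq_zero] at h0
      rw [h0, mem_ofPred_eq, abs_zero] at ht
      linarith
    have h3 := h2 t
    rw [hat] at h3
    rw [h3]
    field_simp
  have hcompl : {t : ℝ | 1 < |t|} = (Icc (-1 : ℝ) 1)ᶜ := by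
    ext t
    rw [mem_ofPred_eq, mem_compl_iff, mem_Icc, ← abs_le, not_le]
  rw [fourier_apply, hin, hout, sub_neg_eq_add, hcompl,
    integral_add_compl measurableSet_Icc hfi]

/-! ### The transform of `e^{ia/x}` -/

theorem integral_hat (φ : 𝓢(ℝ, ℂ)) : ∫ t, hat φ t = 2 * Real.pi * φ 0 := by
  have h := integral_exp_mul_hat φ 0
  simpa using h

theorem integrable_besselSeries_mul (n : ℕ) {b : ℝ} (hb : 0 ≤ b) {g : ℝ → ℂ} (hg : Integrable g) :
    Integrable fun s : ℝ => ((besselSeries n (b * |s|) : ℝ) : ℂ) * g s := by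
  refine hg.bdd_mul (c := 1) (Continuous.aestronglyMeasurable ?_)
    (Eventually.of_forall fun s => ?_)
  · have := continuous_besselSeries n
    fun_prop
  · rw [Complex.norm_real, Real.norm_eq_abs]
    exact abs_besselSeries_le_one n _ (by positivity)

/-- The real part of a/(ε - it) is aε/|ε - it|² ≥ 0. -/
theorem norm_cexp_neg_div_le {a ε : ℝ} (ha : 0 ≤ a) (hε : 0 ≤ ε) (t : ℝ) :
    ‖Complex.exp (-((a : ℂ) / ((ε : ℂ) - Complex.I * t)))‖ ≤ 1 := by
  rw [Complex.norm_exp, Real.exp_le_one_iff, Complex.neg_re, neg_nonpos, Complex.div_re]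
  simp only [Complex.ofReal_re, Complex.sub_re, Complex.mul_re, Complex.I_re, zero_mul,
    Complex.I_im, Complex.ofReal_im, mul_zero, sub_self, sub_zero, zero_div, add_zero]
  exact div_nonneg (mul_nonneg ha hε) (Complex.normSq_nonneg _)

/-- The Laplace formula at p = ε - it is inserted under the integral against φ̂; Fubini leaves ∫
e^{ist} φ̂(t) dt, which inversion evaluates as 2πφ(s). -/
theorem integral_hat_mul_one_sub_cexp {a ε : ℝ} (ha : 0 < a) (hε : 0 < ε) (φ : 𝓢(ℝ, ℂ)) :
    ∫ t : ℝ, hat φ t * (1 - Complex.exp (-((a : ℂ) / ((ε : ℂ) - Complex.I * t)))) =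
      2 * Real.pi * ∫ s in Ioi (0 : ℝ),
        ((a * besselSeries 1 (a * s) * Real.exp (-(ε * s)) : ℝ) : ℂ) * φ s := by
  have hk : Continuous (Function.uncurry fun s t : ℝ => Complex.exp (Complex.I * s * t)) := by
    simp only [Function.uncurry_def]
    fun_prop
  have hkb : ∀ s t : ℝ, ‖Complex.exp (Complex.I * s * t)‖ ≤ 1 := by
    intro s t
    have h := norm_kernel s (-t)
    rw [show -(Complex.I * s * ((-t : ℝ) : ℂ)) = Complex.I * s * t by push_cast; ring] at h
    exact h.le
  -- The damping e^{-εs} makes the kernel integrable, which Fubini requires; boundedness of E_1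
  -- alone would not suffice.
  have hΨ : IntegrableOn (fun s : ℝ =>
      ((a * besselSeries 1 (a * s) * Real.exp (-(ε * s)) : ℝ) : ℂ)) (Ioi 0) := by
    have h0 : IntegrableOn (fun s : ℝ => a * Real.exp (-(ε * s))) (Ioi 0) := by
      simpa [IntegrableOn] using (integrableOn_pow_mul_exp_neg 0 hε).const_mul a
    refine h0.mono' (Continuous.aestronglyMeasurable ?_)
      ((ae_restrict_iff' measurableSet_Ioi).2 (Eventually.of_forall fun s hs => ?_))
    · have := continuous_besselSeries 1
      fun_prop
    · rw [Complex.norm_real, norm_mul, norm_mul, Real.norm_eq_abs, Real.norm_eq_abs,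
        Real.norm_eq_abs, abs_of_pos ha, Real.abs_exp]
      have := abs_besselSeries_le_one 1 (a * s) (mul_nonneg ha.le (mem_Ioi.1 hs).le)
      gcongr
      exact mul_le_of_le_one_right ha.le this
  have h := integral_kernel_swap hk hkb (integrable_hat φ) hΨ
  have h1 : ∀ t : ℝ, ∫ s in Ioi (0 : ℝ), Complex.exp (Complex.I * s * t) *
      ((a * besselSeries 1 (a * s) * Real.exp (-(ε * s)) : ℝ) : ℂ) =
      1 - Complex.exp (-((a : ℂ) / ((ε : ℂ) - Complex.I * t))) := by
    intro t
    rw [← integral_besselSeries_mul_cexp_neg ha (p := (ε : ℂ) - Complex.I * t) (by simpa using hε)]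
    refine integral_congr_ae (Eventually.of_forall fun s => ?_)
    have : Complex.exp (-(((ε : ℂ) - Complex.I * t) * s)) =
        Complex.exp (Complex.I * s * t) * Complex.exp (-(ε * s)) := by
      rw [← Complex.exp_add]; congr 1; ring
    simp only [this]
    push_cast
    ring
  simp_rw [h1, integral_exp_mul_hat] at h
  rw [← h, ← integral_const_mul]
  refine integral_congr_ae (Eventually.of_forall fun s => ?_)
  simp only []
  ring

/-- Limit ε → 0+ of the damped identity, with majorants 2|φ̂| on the left and a|φ| on the right.
Pointwise convergence on the left needs t ≠ 0, where -a/(ε - it) → -ia/t. -/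
theorem integral_cexp_neg_div_mul_hat {a : ℝ} (ha : 0 < a) (φ : 𝓢(ℝ, ℂ)) :
    ∫ t : ℝ, Complex.exp (((-a / t : ℝ) : ℂ) * Complex.I) * hat φ t =
      2 * Real.pi * φ 0 -
        2 * Real.pi * ∫ s in Ioi (0 : ℝ), ((a * besselSeries 1 (a * s) : ℝ) : ℂ) * φ s := by
  have hL : Tendsto (fun ε : ℝ => ∫ t : ℝ, hat φ t *
      (1 - Complex.exp (-((a : ℂ) / ((ε : ℂ) - Complex.I * t))))) (𝓝[>] 0)
      (𝓝 (∫ t : ℝ, hat φ t * (1 - Complex.exp (((-a / t : ℝ) : ℂ) * Complex.I)))) := by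
    refine tendsto_integral_filter_of_dominated_convergence (fun t => ‖hat φ t‖ * 2)
      (Eventually.of_forall fun ε => ?_) ?_ ((integrable_hat φ).norm.mul_const 2) ?_
    · exact (integrable_hat φ).aestronglyMeasurable.mul
        (Measurable.aestronglyMeasurable (by fun_prop))
    · filter_upwards [self_mem_nhdsWithin] with ε hε
      refine Eventually.of_forall fun t => ?_
      rw [norm_mul]
      refine mul_le_mul_of_nonneg_left ((norm_sub_le _ _).trans ?_) (norm_nonneg _)
      have := norm_cexp_neg_div_le ha.le (le_of_lt hε) t
      rw [norm_one]
      linarith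
    · have h0 : ∀ᵐ t : ℝ, t ≠ 0 := by simp [ae_iff]
      filter_upwards [h0] with t ht
      have htc : (t : ℂ) ≠ 0 := by exact_mod_cast ht
      have hc : ContinuousAt (fun ε : ℝ => hat φ t *
          (1 - Complex.exp (-((a : ℂ) / ((ε : ℂ) - Complex.I * t))))) 0 := by
        have : ((0 : ℝ) : ℂ) - Complex.I * t ≠ 0 := by simp [ht]
        fun_prop (disch := assumption)
      have h1 := hc.tendsto.mono_left (nhdsWithin_le_nhds (s := Ioi 0))
      have h2 : -((a : ℂ) / (((0 : ℝ) : ℂ) - Complex.I * t)) = ((-a / t : ℝ) : ℂ) * Complex.I := by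
        push_cast
        rw [zero_sub, div_neg, neg_neg, div_eq_iff (mul_ne_zero Complex.I_ne_zero htc)]
        field_simp
        rw [Complex.I_sq]; ring
      rwa [h2] at h1
  have hR : Tendsto (fun ε : ℝ => 2 * (Real.pi : ℂ) * ∫ s in Ioi (0 : ℝ),
        ((a * besselSeries 1 (a * s) * Real.exp (-(ε * s)) : ℝ) : ℂ) * φ s) (𝓝[>] 0)
      (𝓝 (2 * Real.pi * ∫ s in Ioi (0 : ℝ), ((a * besselSeries 1 (a * s) : ℝ) : ℂ) * φ s)) := by
    refine Tendsto.const_mul _ (tendsto_integral_filter_of_dominated_convergence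
      (fun s => a * ‖φ s‖) (Eventually.of_forall fun ε => ?_) ?_
      (φ.integrable.norm.const_mul a).integrableOn (Eventually.of_forall fun s => ?_))
    · have := continuous_besselSeries 1
      have := φ.continuous
      exact Continuous.aestronglyMeasurable (by fun_prop)
    · filter_upwards [self_mem_nhdsWithin] with ε hε
      refine (ae_restrict_iff' measurableSet_Ioi).2 (Eventually.of_forall fun s hs => ?_)
      rw [norm_mul, Complex.norm_real, norm_mul, norm_mul, Real.norm_eq_abs, Real.norm_eq_abs,
        Real.norm_eq_abs, abs_of_pos ha, Real.abs_exp]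
      have h1 := abs_besselSeries_le_one 1 (a * s) (mul_nonneg ha.le (mem_Ioi.1 hs).le)
      have h2 : Real.exp (-(ε * s)) ≤ 1 :=
        Real.exp_le_one_iff.2 (neg_nonpos.2 (mul_pos hε hs).le)
      refine mul_le_mul_of_nonneg_right ?_ (norm_nonneg _)
      rw [mul_assoc]
      exact mul_le_of_le_one_right ha.le (mul_le_one₀ h1 (Real.exp_pos _).le h2)
    · have hc : Continuous (fun ε : ℝ =>
          ((a * besselSeries 1 (a * s) * Real.exp (-(ε * s)) : ℝ) : ℂ) * φ s) := by fun_prop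
      have h1 := (hc.tendsto 0).mono_left (nhdsWithin_le_nhds (s := Ioi 0))
      simpa using h1
  have heq := tendsto_nhds_unique (hL.congr' (by
    filter_upwards [self_mem_nhdsWithin] with ε hε
    exact integral_hat_mul_one_sub_cexp ha hε φ)) hR
  rw [← heq, ← integral_hat φ, ← integral_sub (integrable_hat φ)]
  · refine integral_congr_ae (Eventually.of_forall fun t => ?_)
    simp only []
    ring
  · refine (integrable_hat φ).mul_bdd (c := 2) (Measurable.aestronglyMeasurable (by fun_prop))
      (Eventually.of_forall fun t => (norm_sub_le _ _).trans ?_)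
    rw [Complex.norm_exp_ofReal_mul_I]
    norm_num

/-- The regular part of the transform of `e^{ia/x}`, up to the factor `-2π`. -/
def expKernel (a s : ℝ) : ℝ :=
  if a * s < 0 then |a| * besselSeries 1 |a * s| else 0

theorem measurable_expKernel (a : ℝ) : Measurable (expKernel a) := by
  unfold expKernel
  have h := (continuous_besselSeries 1).measurable
  exact Measurable.ite (measurableSet_lt (by fun_prop) measurable_const) (by fun_prop)
    measurable_const

theorem abs_expKernel_le (a s : ℝ) : |expKernel a s| ≤ |a| := by
  unfold expKernel
  split_ifs
  · rw [abs_mul, abs_abs]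
    exact mul_le_of_le_one_right (abs_nonneg _) (abs_besselSeries_le_one 1 _ (abs_nonneg _))
  · simp

theorem integrable_expKernel_mul (a : ℝ) {g : ℝ → ℂ} (hg : Integrable g) :
    Integrable fun s => ((expKernel a s : ℝ) : ℂ) * g s := by
  refine hg.bdd_mul (c := |a|) ?_ (Eventually.of_forall fun s => ?_)
  · exact (Complex.measurable_ofReal.comp (measurable_expKernel a)).aestronglyMeasurable
  · rw [Complex.norm_real]; exact abs_expKernel_le a s

/-- The reflection of a Schwartz function. -/
def reflect (φ : 𝓢(ℝ, ℂ)) : 𝓢(ℝ, ℂ) :=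
  SchwartzMap.compCLMOfContinuousLinearEquiv ℂ (ContinuousLinearEquiv.neg ℝ) φ

theorem reflect_apply (φ : 𝓢(ℝ, ℂ)) (s : ℝ) : reflect φ s = φ (-s) := rfl

theorem integral_cexp_div_mul_hat {a : ℝ} (ha : a ≠ 0) (φ : 𝓢(ℝ, ℂ)) :
    ∫ t : ℝ, Complex.exp (((a / t : ℝ) : ℂ) * Complex.I) * hat φ t =
      2 * Real.pi * φ 0 - 2 * Real.pi * ∫ s : ℝ, ((expKernel a s : ℝ) : ℂ) * φ s := by
  rcases ha.lt_or_gt with h | h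
  · have h1 := integral_cexp_neg_div_mul_hat (neg_pos.2 h) φ
    rw [neg_neg] at h1
    rw [h1, ← integral_indicator measurableSet_Ioi]
    congr 3
    ext s
    by_cases hs : 0 < s
    · have h2 : a * s < 0 := mul_neg_of_neg_of_pos h hs
      rw [indicator_of_mem (mem_Ioi.2 hs), expKernel, if_pos h2, abs_of_neg h2, abs_of_neg h,
        neg_mul a s]
    · have h2 : ¬ a * s < 0 := by nlinarith
      rw [indicator_of_notMem (mt mem_Ioi.1 hs), expKernel, if_neg h2, Complex.ofReal_zero, zero_mul]
  -- Replacing t by -t turns e^{-ia/t} into e^{ia/t} and moves the kernel to the negative half-line.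
  · have h1 := integral_cexp_neg_div_mul_hat h (reflect φ)
    have e1 : ∫ t : ℝ, Complex.exp (((-a / t : ℝ) : ℂ) * Complex.I) * hat (reflect φ) t =
        ∫ t : ℝ, Complex.exp (((a / t : ℝ) : ℂ) * Complex.I) * hat φ t := by
      rw [← integral_neg_eq_self]
      refine integral_congr_ae (Eventually.of_forall fun t => ?_)
      have : hat (reflect φ) (-t) = hat φ t := by
        have := hat_reflect φ (-t)
        rw [neg_neg] at this
        exact this
      simp only [this, neg_div_neg_eq]
    rw [e1] at h1
    rw [h1, reflect_apply, neg_zero, ← integral_indicator measurableSet_Ioi,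
      ← integral_neg_eq_self (fun s : ℝ => ((expKernel a s : ℝ) : ℂ) * φ s)]
    congr 3
    ext s
    by_cases hs : 0 < s
    · have h2 : a * -s < 0 := by nlinarith
      rw [indicator_of_mem (mem_Ioi.2 hs), expKernel, if_pos h2, abs_of_neg h2, abs_of_pos h,
        mul_neg, neg_neg, reflect_apply]
    · have h2 : ¬ a * -s < 0 := by nlinarith
      rw [indicator_of_notMem (mt mem_Ioi.1 hs), expKernel, if_neg h2, Complex.ofReal_zero, zero_mul]

/-! ### Transforms of the form `c δ + K` -/

/-- The pairing of `f` with the transforms of Schwartz functions is given by `c δ + K`. -/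
def HasTransform (f : ℝ → ℂ) (c : ℂ) (K : ℝ → ℂ) : Prop :=
  ∀ φ : 𝓢(ℝ, ℂ), Integrable (fun t => f t * hat φ t) ∧ Integrable (fun s => K s * φ s) ∧
    ∫ t, f t * hat φ t = c * φ 0 + ∫ s, K s * φ s

namespace HasTransform

variable {f g : ℝ → ℂ} {c d : ℂ} {K L : ℝ → ℂ}

theorem add (hf : HasTransform f c K) (hg : HasTransform g d L) :
    HasTransform (fun t => f t + g t) (c + d) (fun s => K s + L s) := by
  intro φ
  obtain ⟨h1, h2, h3⟩ := hf φ
  obtain ⟨h1', h2', h3'⟩ := hg φ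
  simp only [add_mul]
  refine ⟨h1.add h1', h2.add h2', ?_⟩
  rw [integral_add h1 h1', integral_add h2 h2', h3, h3']
  ring

theorem const_mul (b : ℂ) (hf : HasTransform f c K) :
    HasTransform (fun t => b * f t) (b * c) (fun s => b * K s) := by
  intro φ
  obtain ⟨h1, h2, h3⟩ := hf φ
  simp only [mul_assoc]
  refine ⟨h1.const_mul b, h2.const_mul b, ?_⟩
  rw [integral_const_mul, integral_const_mul, h3]
  ring

theorem zero : HasTransform (fun _ => 0) 0 (fun _ => 0) := by
  intro φ
  simp

theorem sum {ι : Type*} (S : Finset ι) {f : ι → ℝ → ℂ} {c : ι → ℂ} {K : ι → ℝ → ℂ}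
    (h : ∀ i ∈ S, HasTransform (f i) (c i) (K i)) :
    HasTransform (fun t => ∑ i ∈ S, f i t) (∑ i ∈ S, c i) (fun s => ∑ i ∈ S, K i s) := by
  classical
  induction S using Finset.induction_on with
  | empty => simpa using zero
  | insert i S hi ih =>
    simp only [Finset.sum_insert hi]
    exact (h i (Finset.mem_insert_self i S)).add
      (ih fun j hj => h j (Finset.mem_insert_of_mem hj))

theorem one : HasTransform (fun _ => 1) (2 * Real.pi) (fun _ => 0) := by
  intro φ
  simpa [integral_hat] using integrable_hat φ

/-- This absorbs the point s = 0, where the closed Bessel formulas divide by zero. -/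
theorem congr_ae (hf : HasTransform f c K) (h : K =ᵐ[volume] L) : HasTransform f c L := by
  intro φ
  obtain ⟨h1, h2, h3⟩ := hf φ
  have h4 : (fun s => K s * φ s) =ᵐ[volume] fun s => L s * φ s := h.mul (EventuallyEq.refl _ φ)
  exact ⟨h1, h2.congr h4, by rw [h3, integral_congr_ae h4]⟩

theorem eqDeltaAdd (h : HasTransform f c K) (hf : MemLp f ∞ volume) :
    EqDeltaAdd (fourier f hf) c K := by
  intro φ
  obtain ⟨-, h2, h3⟩ := h φ
  rw [fourier_apply_eq_integral_hat, TemperedDistribution.delta_apply]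
  exact ⟨h2, h3⟩

/-- Fubini on the bounded window turns the pairing into ∫_{-R}^R f φ̂, and f φ̂ is integrable on the
line. -/
theorem tendstoDeltaAdd (h : HasTransform f c K) (hf : MemLp f ∞ volume) :
    TendstoDeltaAdd
      (fun R s : ℝ => ∫ t in (-R)..R, Complex.exp (-(Complex.I * s * t)) * f t) atTop c K := by
  intro φ
  obtain ⟨h1, h2, h3⟩ := h φ
  have hi : ∀ R : ℝ, IntegrableOn f (Ioc (-R) R) := fun R =>
    (hf.restrict (Ioc (-R) R)).integrable le_top
  refine ⟨h2, ?_, ?_⟩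
  · filter_upwards [eventually_ge_atTop 0] with R hR
    simp only [intervalIntegral.integral_of_le (by linarith : -R ≤ R)]
    exact integrable_kernel_transform_mul continuous_exp_kernel
      (fun s t => (norm_kernel s t).le) (hi R) φ.integrable
  · rw [TemperedDistribution.delta_apply, ← h3]
    refine (intervalIntegral_tendsto_integral h1 tendsto_neg_atTop_atBot tendsto_id).congr' ?_
    filter_upwards [eventually_ge_atTop 0] with R hR
    simp only [id, intervalIntegral.integral_of_le (by linarith : -R ≤ R)]
    exact (integral_kernel_swap continuous_exp_kernel
      (fun s t => (norm_kernel s t).le) (hi R) φ.integrable).symm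

end HasTransform

theorem TendstoDeltaAdd.congr_comp {ι κ : Type} {u : ι → ℝ → ℂ} {v : κ → ℝ → ℂ} {l : Filter ι}
    {m : Filter κ} {c : ℂ} {K : ℝ → ℂ} (h : TendstoDeltaAdd u l c K) {g : κ → ι}
    (hg : Tendsto g m l) (huv : ∀ᶠ r in m, ∀ s, u (g r) s = v r s) : TendstoDeltaAdd v m c K := by
  intro φ
  obtain ⟨h1, h2, h3⟩ := h φ
  refine ⟨h1, ?_, (h3.comp hg).congr' ?_⟩
  · filter_upwards [hg.eventually h2, huv] with r hr hr'
    simpa only [hr'] using hr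
  · filter_upwards [huv] with r hr
    simp only [Function.comp, hr]

/-! ### Boundedness of the functions; the transforms of e^{ia/x} and cos(a/x) -/

theorem memLp_top_of_norm_le {f : ℝ → ℂ} (hm : Measurable f) {C : ℝ} (hC : ∀ x, ‖f x‖ ≤ C) :
    MemLp f ∞ volume :=
  memLp_top_of_bound hm.aestronglyMeasurable C (Eventually.of_forall hC)

theorem memLp_cexp_div (a : ℝ) :
    MemLp (fun x : ℝ => Complex.exp (((a / x : ℝ) : ℂ) * Complex.I)) ∞ volume :=
  memLp_top_of_norm_le (by fun_prop) fun _ => (Complex.norm_exp_ofReal_mul_I _).le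

theorem memLp_cos_div_pow (a : ℝ) (m : ℕ) :
    MemLp (fun x : ℝ => ((Real.cos (a / x) ^ m : ℝ) : ℂ)) ∞ volume := by
  refine memLp_top_of_norm_le (C := 1) (by fun_prop) fun x => ?_
  rw [Complex.norm_real, norm_pow]
  exact pow_le_one₀ (norm_nonneg _) (Real.abs_cos_le_one _)

theorem memLp_cos_div (a : ℝ) :
    MemLp (fun x : ℝ => ((Real.cos (a / x) : ℝ) : ℂ)) ∞ volume := by
  simpa using memLp_cos_div_pow a 1

theorem memLp_mul_sin_div (a : ℝ) :
    MemLp (fun x : ℝ => ((x * Real.sin (a / x) : ℝ) : ℂ)) ∞ volume := by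
  refine memLp_top_of_norm_le (C := |a|) (by fun_prop) fun x => ?_
  rw [Complex.norm_real, norm_mul, Real.norm_eq_abs, Real.norm_eq_abs]
  rcases eq_or_ne x 0 with rfl | hx
  · simp
  · calc |x| * |Real.sin (a / x)| ≤ |x| * |a / x| :=
          mul_le_mul_of_nonneg_left Real.abs_sin_le_abs (abs_nonneg _)
      _ = |a| := by rw [← abs_mul, mul_div_cancel₀ _ hx]

theorem hasTransform_cexp_div {a : ℝ} (ha : a ≠ 0) :
    HasTransform (fun x : ℝ => Complex.exp (((a / x : ℝ) : ℂ) * Complex.I)) (2 * Real.pi)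
      (fun s => ((-(2 * Real.pi * expKernel a s) : ℝ) : ℂ)) := by
  intro φ
  have e : ∀ s : ℝ, ((-(2 * Real.pi * expKernel a s) : ℝ) : ℂ) * φ s =
      (-(2 * Real.pi) : ℂ) * (((expKernel a s : ℝ) : ℂ) * φ s) := by
    intro s; push_cast; ring
  simp only [e]
  refine ⟨Integrable.mul_of_top_right (integrable_hat φ) (memLp_cexp_div a),
    (integrable_expKernel_mul a φ.integrable).const_mul _, ?_⟩
  rw [integral_cexp_div_mul_hat ha, integral_const_mul]
  ring

theorem sqrt_abs_mul_besselJ_one_div (a : ℝ) {s : ℝ} (hs : s ≠ 0) :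
    √|a| * besselJ 1 (2 * √|a * s|) / √|s| = |a| * besselSeries 1 |a * s| := by
  have h1 : √|s| ≠ 0 := (Real.sqrt_pos.2 (abs_pos.2 hs)).ne'
  rw [besselJ_two_mul_sqrt 1 (abs_nonneg _), pow_one, abs_mul, Real.sqrt_mul (abs_nonneg a),
    div_eq_iff h1]
  linear_combination (√|s| * besselSeries 1 (|a| * |s|)) * Real.mul_self_sqrt (abs_nonneg a)

theorem two_mul_pi_mul_expKernel (a s : ℝ) :
    2 * Real.pi * expKernel a s = if a * s < 0 then
      2 * Real.pi * √|a| * besselJ 1 (2 * √|a * s|) / √|s| else 0 := by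
  rw [expKernel]
  split_ifs with h
  · have hs : s ≠ 0 := by rintro rfl; simp at h
    rw [← sqrt_abs_mul_besselJ_one_div a hs]
    ring
  · simp

theorem expKernel_add_expKernel_neg {a s : ℝ} (ha : a ≠ 0) (hs : s ≠ 0) :
    expKernel a s + expKernel (-a) s = |a| * besselSeries 1 |a * s| := by
  rw [expKernel, expKernel, neg_mul, abs_neg, abs_neg]
  rcases (mul_ne_zero ha hs).lt_or_gt with h | h
  · rw [if_pos h, if_neg (by linarith), add_zero]
  · rw [if_neg (by linarith), if_pos (by linarith), zero_add]

theorem ae_ne_zero : ∀ᵐ s : ℝ, s ≠ 0 := by simp [ae_iff]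

/-- The one-sided kernels for a and -a live on complementary half-lines, so their average is half of
a single even kernel. -/
theorem hasTransform_cos_div {a : ℝ} (ha : a ≠ 0) :
    HasTransform (fun x : ℝ => ((Real.cos (a / x) : ℝ) : ℂ)) (2 * Real.pi)
      (fun s => ((-(Real.pi * √|a| * besselJ 1 (2 * √|a * s|) / √|s|) : ℝ) : ℂ)) := by
  have h := ((hasTransform_cexp_div ha).add (hasTransform_cexp_div (neg_ne_zero.2 ha))).const_mul
    (1 / 2)
  have e1 : (fun x : ℝ => ((Real.cos (a / x) : ℝ) : ℂ)) = fun x : ℝ => 1 / 2 *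
      (Complex.exp (((a / x : ℝ) : ℂ) * Complex.I) +
        Complex.exp (((-a / x : ℝ) : ℂ) * Complex.I)) := by
    ext x
    rw [Complex.ofReal_cos, Complex.cos, neg_div, Complex.ofReal_neg]
    ring
  have e2 : (2 * Real.pi : ℂ) = 1 / 2 * (2 * Real.pi + 2 * Real.pi) := by ring
  rw [e1, e2]
  refine h.congr_ae ?_
  filter_upwards [ae_ne_zero] with s hs
  have h1 := expKernel_add_expKernel_neg ha hs
  rw [← sqrt_abs_mul_besselJ_one_div a hs] at h1
  have h2 : -(Real.pi * √|a| * besselJ 1 (2 * √|a * s|) / √|s|) =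
      1 / 2 * (-(2 * Real.pi * expKernel a s) + -(2 * Real.pi * expKernel (-a) s)) := by
    linear_combination Real.pi * h1
  rw [h2]
  push_cast
  ring

theorem sqrt_abs_div (a s : ℝ) : √|a / s| = √|a| / √|s| := by
  rw [abs_div, Real.sqrt_div (abs_nonneg a)]

/-! ### Integration by parts for `x sin(a/x)` -/

/-- Integration by parts with E_n' = -E_{n+1}. The boundary term at infinity vanishes because |E_n|
≤ 1 and φ decays. The absolute value lets one integrand serve both half-lines. -/
theorem integral_Ioi_besselSeries_mul_deriv (n : ℕ) {b : ℝ} (hb : 0 ≤ b) (φ : 𝓢(ℝ, ℂ)) :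
    ∫ s in Ioi (0 : ℝ), ((besselSeries n (b * |s|) : ℝ) : ℂ) * deriv φ s =
      -((besselSeries n 0 : ℝ) : ℂ) * φ 0 +
        b * ∫ s in Ioi (0 : ℝ), ((besselSeries (n + 1) (b * |s|) : ℝ) : ℂ) * φ s := by
  have hd : ∀ s : ℝ, HasDerivAt (fun s : ℝ => ((besselSeries n (b * s) : ℝ) : ℂ) * φ s)
      (((besselSeries n (b * s) : ℝ) : ℂ) * deriv φ s -
        b * (((besselSeries (n + 1) (b * s) : ℝ) : ℂ) * φ s)) s := by
    intro s
    have h1 : HasDerivAt (fun s : ℝ => besselSeries n (b * s))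
        (-besselSeries (n + 1) (b * s) * b) s := by
      have := (hasDerivAt_besselSeries n (b * s)).comp s ((hasDerivAt_id s).const_mul b)
      rw [mul_one] at this
      exact this
    refine (h1.ofReal_comp.mul φ.differentiableAt.hasDerivAt).congr_deriv ?_
    push_cast
    ring
  have i1 : IntegrableOn (fun s : ℝ => ((besselSeries n (b * s) : ℝ) : ℂ) * deriv φ s)
      (Ioi 0) := by
    refine (integrable_besselSeries_mul n hb
      ((SchwartzMap.derivCLM ℂ ℂ φ).integrable (μ := volume))).integrableOn.congr_fun
      (fun s hs => ?_) measurableSet_Ioi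
    simp only [abs_of_pos (mem_Ioi.1 hs), SchwartzMap.derivCLM_apply]
  have i2 : IntegrableOn (fun s : ℝ => ((besselSeries (n + 1) (b * s) : ℝ) : ℂ) * φ s)
      (Ioi 0) := by
    refine (integrable_besselSeries_mul (n + 1) hb φ.integrable).integrableOn.congr_fun
      (fun s hs => ?_) measurableSet_Ioi
    simp only [abs_of_pos (mem_Ioi.1 hs)]
  have hlim : Tendsto (fun s : ℝ => ((besselSeries n (b * s) : ℝ) : ℂ) * φ s) atTop (𝓝 0) := by
    have h0 : Tendsto φ atTop (𝓝 0) := φ.tendsto_cocompact.mono_left atTop_le_cocompact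
    refine squeeze_zero_norm' ?_ (tendsto_zero_iff_norm_tendsto_zero.1 h0)
    filter_upwards [eventually_ge_atTop 0] with s hs
    rw [norm_mul, Complex.norm_real]
    exact mul_le_of_le_one_left (norm_nonneg _)
      (abs_besselSeries_le_one n _ (mul_nonneg hb hs))
  have h := integral_Ioi_of_hasDerivAt_of_tendsto' (a := 0) (fun s _ => hd s)
    (i1.sub (i2.const_mul (b : ℂ))) hlim
  rw [integral_sub i1 (i2.const_mul (b : ℂ)), integral_const_mul, mul_zero] at h
  have c1 : ∫ s in Ioi (0 : ℝ), ((besselSeries n (b * |s|) : ℝ) : ℂ) * deriv φ s =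
      ∫ s in Ioi (0 : ℝ), ((besselSeries n (b * s) : ℝ) : ℂ) * deriv φ s :=
    setIntegral_congr_fun measurableSet_Ioi fun s hs => by simp only [abs_of_pos (mem_Ioi.1 hs)]
  have c2 : ∫ s in Ioi (0 : ℝ), ((besselSeries (n + 1) (b * |s|) : ℝ) : ℂ) * φ s =
      ∫ s in Ioi (0 : ℝ), ((besselSeries (n + 1) (b * s) : ℝ) : ℂ) * φ s :=
    setIntegral_congr_fun measurableSet_Ioi fun s hs => by simp only [abs_of_pos (mem_Ioi.1 hs)]
  rw [c1, c2]
  linear_combination h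

theorem integral_Iic_besselSeries_mul_deriv (n : ℕ) {b : ℝ} (hb : 0 ≤ b) (φ : 𝓢(ℝ, ℂ)) :
    ∫ s in Iic (0 : ℝ), ((besselSeries n (b * |s|) : ℝ) : ℂ) * deriv φ s =
      ((besselSeries n 0 : ℝ) : ℂ) * φ 0 -
        b * ∫ s in Iic (0 : ℝ), ((besselSeries (n + 1) (b * |s|) : ℝ) : ℂ) * φ s := by
  have h := integral_Ioi_besselSeries_mul_deriv n hb (reflect φ)
  have e1 : ∀ s, deriv (reflect φ) s = -deriv φ (-s) := fun s => deriv_comp_neg (f := φ) s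
  have c1 := integral_comp_neg_Ioi 0
    (fun s : ℝ => ((besselSeries n (b * |s|) : ℝ) : ℂ) * deriv φ s)
  have c2 := integral_comp_neg_Ioi 0
    (fun s : ℝ => ((besselSeries (n + 1) (b * |s|) : ℝ) : ℂ) * φ s)
  simp only [abs_neg, neg_zero] at c1 c2
  simp only [e1, reflect_apply, neg_zero, mul_neg, integral_neg, c1, c2] at h
  linear_combination -h

theorem expKernel_sub_expKernel_neg_of_pos {a s : ℝ} (ha : a ≠ 0) (hs : 0 < s) :
    expKernel a s - expKernel (-a) s = -a * besselSeries 1 (|a| * |s|) := by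
  rw [expKernel, expKernel, neg_mul, abs_neg, abs_neg, ← abs_mul]
  rcases ha.lt_or_gt with h | h
  · have h1 : a * s < 0 := mul_neg_of_neg_of_pos h hs
    rw [if_pos h1, if_neg (by linarith), sub_zero, abs_of_neg h]
  · have h1 : 0 < a * s := mul_pos h hs
    rw [if_neg (by linarith), if_pos (by linarith), zero_sub, abs_of_pos h, neg_mul]

theorem expKernel_sub_expKernel_neg_of_neg {a s : ℝ} (ha : a ≠ 0) (hs : s < 0) :
    expKernel a s - expKernel (-a) s = a * besselSeries 1 (|a| * |s|) := by
  have h := expKernel_sub_expKernel_neg_of_pos (neg_ne_zero.2 ha) (neg_pos.2 hs)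
  rw [abs_neg, abs_neg, neg_neg] at h
  rw [← h]
  simp only [expKernel, abs_neg, neg_neg, mul_neg, neg_mul]

/-- The kernel is odd, -a sgn(s) E_1(|as|), with jump -2a at 0. Its distributional derivative
therefore has a point mass at 0, besides a regular part in E_2. -/
theorem integral_expKernel_sub_mul_deriv {a : ℝ} (ha : a ≠ 0) (φ : 𝓢(ℝ, ℂ)) :
    ∫ s, ((expKernel a s - expKernel (-a) s : ℝ) : ℂ) * deriv φ s =
      2 * a * φ 0 - a * |a| * ∫ s, ((besselSeries 2 (|a| * |s|) : ℝ) : ℂ) * φ s := by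
  have hφ' : Integrable (deriv φ) := (SchwartzMap.derivCLM ℂ ℂ φ).integrable (μ := volume)
  have hi : Integrable fun s => ((expKernel a s - expKernel (-a) s : ℝ) : ℂ) * deriv φ s := by
    have := (integrable_expKernel_mul a hφ').sub (integrable_expKernel_mul (-a) hφ')
    refine this.congr (Eventually.of_forall fun s => ?_)
    simp only [Pi.sub_apply]
    push_cast
    ring
  have c1 : ∫ s in Ioi (0 : ℝ), ((expKernel a s - expKernel (-a) s : ℝ) : ℂ) * deriv φ s =
      -a * ∫ s in Ioi (0 : ℝ), ((besselSeries 1 (|a| * |s|) : ℝ) : ℂ) * deriv φ s := by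
    rw [← integral_const_mul]
    refine setIntegral_congr_fun measurableSet_Ioi fun s hs => ?_
    simp only [expKernel_sub_expKernel_neg_of_pos ha (mem_Ioi.1 hs)]
    push_cast
    ring
  have c2 : ∫ s in Iic (0 : ℝ), ((expKernel a s - expKernel (-a) s : ℝ) : ℂ) * deriv φ s =
      a * ∫ s in Iic (0 : ℝ), ((besselSeries 1 (|a| * |s|) : ℝ) : ℂ) * deriv φ s := by
    rw [← integral_const_mul, integral_Iic_eq_integral_Iio, integral_Iic_eq_integral_Iio]
    refine setIntegral_congr_fun measurableSet_Iio fun s hs => ?_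
    simp only [expKernel_sub_expKernel_neg_of_neg ha (mem_Iio.1 hs)]
    push_cast
    ring
  have h2 := integrable_besselSeries_mul 2 (abs_nonneg a) (φ.integrable (μ := volume))
  rw [← intervalIntegral.integral_Iic_add_Ioi (b := 0) hi.integrableOn hi.integrableOn, c1, c2,
    integral_Ioi_besselSeries_mul_deriv 1 (abs_nonneg a),
    integral_Iic_besselSeries_mul_deriv 1 (abs_nonneg a),
    ← intervalIntegral.integral_Iic_add_Ioi (b := 0) h2.integrableOn h2.integrableOn,
    besselSeries_zero_right]
  norm_num
  ring

/-- Moving t onto φ̂ replaces φ by φ'. The multiples of φ'(0) from e^{ia/t} and e^{-ia/t} cancel,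
and integration by parts leaves 2πa δ and a bounded kernel in E_2. -/
theorem hasTransform_mul_sin_div {a : ℝ} (ha : a ≠ 0) :
    HasTransform (fun x : ℝ => ((x * Real.sin (a / x) : ℝ) : ℂ)) (2 * Real.pi * a)
      (fun s : ℝ => ((Real.pi * a * besselJ 0 (2 * √|a * s|) / |s| -
          Real.pi * √|a| * Real.sign a * besselJ 1 (2 * √|a * s|)
            / |s| ^ (3 / 2 : ℝ) : ℝ) : ℂ)) := by
  have key : HasTransform (fun x : ℝ => ((x * Real.sin (a / x) : ℝ) : ℂ)) (2 * Real.pi * a)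
      (fun s : ℝ => ((-(Real.pi * a * |a| * besselSeries 2 (|a| * |s|)) : ℝ) : ℂ)) := by
    intro φ
    have e : ∀ s : ℝ, ((-(Real.pi * a * |a| * besselSeries 2 (|a| * |s|)) : ℝ) : ℂ) * φ s =
        -(Real.pi * a * |a| : ℂ) * (((besselSeries 2 (|a| * |s|) : ℝ) : ℂ) * φ s) := by
      intro s; push_cast; ring
    simp only [e]
    refine ⟨Integrable.mul_of_top_right (integrable_hat φ) (memLp_mul_sin_div a),
      (integrable_besselSeries_mul 2 (abs_nonneg a) φ.integrable).const_mul _, ?_⟩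
    set ψ : 𝓢(ℝ, ℂ) := SchwartzMap.derivCLM ℂ ℂ φ with hψ
    have hψc : (ψ : ℝ → ℂ) = deriv φ := rfl
    have h1 : ∀ t : ℝ, ((t * Real.sin (a / t) : ℝ) : ℂ) * hat φ t =
        -(1 / 2) * (Complex.exp (((a / t : ℝ) : ℂ) * Complex.I) * hat ψ t -
          Complex.exp (((-a / t : ℝ) : ℂ) * Complex.I) * hat ψ t) := by
      intro t
      rw [hψc, hat_deriv, Complex.ofReal_mul, Complex.ofReal_sin, Complex.sin, neg_div,
        Complex.ofReal_neg]
      ring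
    have i1 := Integrable.mul_of_top_right (integrable_hat ψ) (memLp_cexp_div a)
    have i2 := Integrable.mul_of_top_right (integrable_hat ψ) (memLp_cexp_div (-a))
    simp_rw [h1]
    have h2 : ∫ t : ℝ, (Complex.exp (((a / t : ℝ) : ℂ) * Complex.I) * hat ψ t -
          Complex.exp (((-a / t : ℝ) : ℂ) * Complex.I) * hat ψ t) = _ := integral_sub i1 i2
    have h3 := integral_expKernel_sub_mul_deriv ha φ
    have h4 : ∫ s, ((expKernel a s - expKernel (-a) s : ℝ) : ℂ) * deriv φ s =
        (∫ s, ((expKernel a s : ℝ) : ℂ) * ψ s) - ∫ s, ((expKernel (-a) s : ℝ) : ℂ) * ψ s := by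
      rw [← integral_sub (integrable_expKernel_mul a ψ.integrable)
        (integrable_expKernel_mul (-a) ψ.integrable)]
      refine integral_congr_ae (Eventually.of_forall fun s => ?_)
      simp only [hψc]
      push_cast
      ring
    rw [integral_const_mul, h2, integral_const_mul]
    have h5 := integral_cexp_div_mul_hat ha ψ
    have h6 := integral_cexp_div_mul_hat (neg_ne_zero.2 ha) ψ
    rw [h5, h6]
    rw [h4] at h3
    linear_combination (Real.pi : ℂ) * h3
  -- With w = |as| the recurrence reads w E_2 = E_1 - E_0. The J_0 and J_1 terms are each singular
  -- like 1/|s| at 0, but combine into the bounded kernel.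
  refine key.congr_ae ?_
  filter_upwards [ae_ne_zero] with s hs
  have hs' : 0 < |s| := abs_pos.2 hs
  have h1 : |s| ^ (3 / 2 : ℝ) = |s| * √|s| := by
    rw [Real.sqrt_eq_rpow, ← Real.rpow_one_add' hs'.le (by norm_num)]
    norm_num
  have h2 := sqrt_abs_mul_besselJ_one_div a hs
  have h3 := besselSeries_recurrence 0 |a * s|
  have h4 : besselJ 0 (2 * √|a * s|) = besselSeries 0 |a * s| := by
    rw [besselJ_two_mul_sqrt 0 (abs_nonneg _), pow_zero, one_mul]
  have h5 : Real.sign a * |a| = a := by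
    rcases ha.lt_or_gt with h | h
    · rw [Real.sign_of_neg h, abs_of_neg h]; ring
    · rw [Real.sign_of_pos h, abs_of_pos h]; ring
  congr 1
  have h6 : Real.pi * √|a| * Real.sign a * besselJ 1 (2 * √|a * s|) / |s| ^ (3 / 2 : ℝ) =
      Real.pi * Real.sign a * (√|a| * besselJ 1 (2 * √|a * s|) / √|s|) / |s| := by
    rw [h1]
    have := (Real.sqrt_pos.2 hs').ne'
    field_simp
  rw [h6, h2, h4, ← sub_div, eq_div_iff hs'.ne', ← abs_mul]
  have h7 : |a * s| = |a| * |s| := abs_mul a s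
  simp only [Nat.cast_zero, zero_add, one_mul] at h3
  linear_combination Real.pi * a * h3 + Real.pi * besselSeries 1 |a * s| * h5 +
    Real.pi * a * besselSeries 2 |a * s| * h7

/-! ### Powers of the cosine -/

theorem cos_pow_eq_sum (θ : ℝ) (m : ℕ) :
    Real.cos θ ^ m = 1 / 2 ^ m * ∑ k ∈ Finset.range (m + 1),
      (m.choose k : ℝ) * Real.cos ((m - 2 * k) * θ) := by
  have h1 : (2 * Complex.cos θ) ^ m = ∑ k ∈ Finset.range (m + 1),
      (m.choose k : ℂ) * Complex.exp ((((2 * k - m) * θ : ℝ) : ℂ) * Complex.I) := by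
    rw [Complex.two_cos, add_pow]
    refine Finset.sum_congr rfl fun k hk => ?_
    rw [← Complex.exp_nat_mul, ← Complex.exp_nat_mul, ← Complex.exp_add, mul_comm]
    congr 2
    rw [Nat.cast_sub (Nat.lt_succ_iff.1 (Finset.mem_range.1 hk))]
    push_cast
    ring
  have h2 := congrArg Complex.re h1
  rw [Complex.re_sum] at h2
  have h3 : ((2 * Complex.cos θ) ^ m).re = 2 ^ m * Real.cos θ ^ m := by
    have : (2 * Complex.cos θ) ^ m = ((2 ^ m * Real.cos θ ^ m : ℝ) : ℂ) := by
      push_cast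
      rw [mul_pow]
    rw [this, Complex.ofReal_re]
  have h4 : ∀ k : ℕ, ((m.choose k : ℂ) *
      Complex.exp ((((2 * k - m) * θ : ℝ) : ℂ) * Complex.I)).re =
      (m.choose k : ℝ) * Real.cos ((m - 2 * k) * θ) := by
    intro k
    rw [← Complex.ofReal_natCast, Complex.re_ofReal_mul, Complex.exp_ofReal_mul_I_re,
      ← Real.cos_neg]
    congr 2
    ring
  simp_rw [h4] at h2
  rw [← h2, h3]
  field_simp

theorem cos_pow_odd (θ : ℝ) {n : ℕ} (hn : 1 ≤ n) :
    Real.cos θ ^ (2 * n - 1) = 1 / 2 ^ (2 * n - 2) * ∑ k ∈ Finset.range n,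
      ((2 * n - 1).choose k : ℝ) * Real.cos ((2 * n - 2 * k - 1) * θ) := by
  have hpow : (2 : ℝ) ^ (2 * n - 1) = 2 ^ (2 * n - 2) * 2 := by
    rw [← pow_succ]; congr 1; lia
  have hcast : ((2 * n - 1 : ℕ) : ℝ) = 2 * n - 1 := by
    rw [Nat.cast_sub (by lia)]; push_cast; ring
  -- The upper half of the expansion folds onto the lower one: n + k is paired with n - 1 - k by the
  -- symmetry of binomial coefficients and evenness of the cosine.
  have hsymm : ∑ k ∈ Finset.range n, ((2 * n - 1).choose (n + k) : ℝ) *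
      Real.cos ((2 * n - 1 - 2 * (n + k : ℕ)) * θ) = ∑ k ∈ Finset.range n,
      ((2 * n - 1).choose k : ℝ) * Real.cos ((2 * n - 1 - 2 * k) * θ) := by
    rw [← Finset.sum_range_reflect (fun k : ℕ => ((2 * n - 1).choose k : ℝ) *
      Real.cos ((2 * n - 1 - 2 * k) * θ)) n]
    refine Finset.sum_congr rfl fun k hk => ?_
    have hk' := Finset.mem_range.1 hk
    rw [← Nat.choose_symm (by lia : n + k ≤ 2 * n - 1),
      show 2 * n - 1 - (n + k) = n - 1 - k by lia, ← Real.cos_neg]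
    congr 2
    rw [Nat.cast_sub (by lia), Nat.cast_sub (by lia)]
    push_cast
    ring
  rw [cos_pow_eq_sum, show 2 * n - 1 + 1 = n + n by lia, Finset.sum_range_add, hcast, hsymm, hpow]
  have e : ∀ k : ℕ, ((2 * n - 1 - 2 * k) * θ : ℝ) = (2 * n - 2 * k - 1) * θ := fun k => by ring
  simp_rw [e]
  rw [← two_mul]
  generalize ∑ k ∈ Finset.range n, ((2 * n - 1).choose k : ℝ) *
    Real.cos ((2 * n - 2 * k - 1) * θ) = S
  field_simp

theorem cos_pow_even (θ : ℝ) {n : ℕ} (hn : 1 ≤ n) :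
    Real.cos θ ^ (2 * n) = (2 * n).choose n / 2 ^ (2 * n) +
      1 / 2 ^ (2 * n - 1) * ∑ k ∈ Finset.range n,
        ((2 * n).choose k : ℝ) * Real.cos ((2 * n - 2 * k) * θ) := by
  have hpow : (2 : ℝ) ^ (2 * n) = 2 ^ (2 * n - 1) * 2 := by
    rw [← pow_succ]; congr 1; lia
  have hsymm : ∑ k ∈ Finset.range n, ((2 * n).choose (n + 1 + k) : ℝ) *
      Real.cos ((2 * n - 2 * (n + 1 + k : ℕ)) * θ) = ∑ k ∈ Finset.range n,
      ((2 * n).choose k : ℝ) * Real.cos ((2 * n - 2 * k) * θ) := by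
    rw [← Finset.sum_range_reflect (fun k : ℕ => ((2 * n).choose k : ℝ) *
      Real.cos ((2 * n - 2 * k) * θ)) n]
    refine Finset.sum_congr rfl fun k hk => ?_
    have hk' := Finset.mem_range.1 hk
    rw [← Nat.choose_symm (by lia : n + 1 + k ≤ 2 * n),
      show 2 * n - (n + 1 + k) = n - 1 - k by lia, ← Real.cos_neg]
    congr 2
    rw [Nat.cast_sub (by lia), Nat.cast_sub (by lia)]
    push_cast
    ring
  rw [cos_pow_eq_sum, show 2 * n + 1 = n + 1 + n by lia, Finset.sum_range_add,
    Finset.sum_range_succ]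
  push_cast at hsymm ⊢
  rw [hsymm, hpow, sub_self, zero_mul, Real.cos_zero]
  generalize ∑ k ∈ Finset.range n, ((2 * n).choose k : ℝ) * Real.cos ((2 * n - 2 * k) * θ) = S
  field_simp
  ring

theorem hasTransform_sum_cos_div {ι : Type*} (S : Finset ι) (w b : ι → ℝ)
    (hb : ∀ i ∈ S, b i ≠ 0) :
    HasTransform (fun x : ℝ => ((∑ i ∈ S, w i * Real.cos (b i / x) : ℝ) : ℂ))
      (2 * Real.pi * ((∑ i ∈ S, w i : ℝ) : ℂ))
      (fun s => ((-(Real.pi * ∑ i ∈ S, w i * √|b i / s| * besselJ 1 (2 * √|b i * s|)) : ℝ)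
        : ℂ)) := by
  have h := HasTransform.sum S fun i hi => (hasTransform_cos_div (hb i hi)).const_mul (w i : ℂ)
  convert h using 1
  · ext x
    push_cast
    rfl
  · push_cast
    rw [Finset.mul_sum]
    refine Finset.sum_congr rfl fun i _ => ?_
    ring
  · ext s
    simp only [← Complex.ofReal_mul, ← Complex.ofReal_sum]
    rw [Finset.mul_sum, ← Finset.sum_neg_distrib]
    congr 1
    refine Finset.sum_congr rfl fun i _ => ?_
    rw [sqrt_abs_div]
    ring

theorem hasTransform_cos_div_pow_odd {a : ℝ} (ha : a ≠ 0) {n : ℕ} (hn : 1 ≤ n) :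
    HasTransform (fun x : ℝ => ((Real.cos (a / x) ^ (2 * n - 1) : ℝ) : ℂ)) (2 * Real.pi)
      (fun s : ℝ => ((-(Real.pi / 2 ^ (2 * n - 2) * ∑ k ∈ Finset.range n,
        ((2 * n - 1).choose k : ℝ) * √|(2 * n - 2 * k - 1) * a / s| *
          besselJ 1 (2 * √|(2 * n - 2 * k - 1) * a * s|)) : ℝ) : ℂ)) := by
  have hb : ∀ k ∈ Finset.range n, (2 * n - 2 * k - 1 : ℝ) * a ≠ 0 := by
    intro k hk
    have : (k + 1 : ℝ) ≤ n := by exact_mod_cast Finset.mem_range.1 hk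
    exact mul_ne_zero (by linarith) ha
  have h := (hasTransform_sum_cos_div (Finset.range n) (fun k => ((2 * n - 1).choose k : ℝ)) _
    hb).const_mul ((1 / 2 ^ (2 * n - 2) : ℝ) : ℂ)
  -- At θ = 0 the expansion says that the weights add up to 1, which makes the coefficient of δ
  -- equal to 2π.
  have h0 := cos_pow_odd 0 hn
  simp only [mul_zero, Real.cos_zero, one_pow, mul_one] at h0
  convert h using 1
  · ext x
    rw [cos_pow_odd _ hn, ← Complex.ofReal_mul]
    simp only [mul_div_assoc]
  · rw [mul_left_comm, ← Complex.ofReal_mul, ← h0, Complex.ofReal_one, mul_one]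
  · ext s
    rw [← Complex.ofReal_mul]
    congr 1
    ring

theorem hasTransform_cos_div_pow_even {a : ℝ} (ha : a ≠ 0) {n : ℕ} (hn : 1 ≤ n) :
    HasTransform (fun x : ℝ => ((Real.cos (a / x) ^ (2 * n) : ℝ) : ℂ)) (2 * Real.pi)
      (fun s : ℝ => ((-(Real.pi / 2 ^ (2 * n - 1) * ∑ k ∈ Finset.range n,
        ((2 * n).choose k : ℝ) * √|(2 * n - 2 * k) * a / s| *
          besselJ 1 (2 * √|(2 * n - 2 * k) * a * s|)) : ℝ) : ℂ)) := by
  have hb : ∀ k ∈ Finset.range n, (2 * n - 2 * k : ℝ) * a ≠ 0 := by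
    intro k hk
    have : (k + 1 : ℝ) ≤ n := by exact_mod_cast Finset.mem_range.1 hk
    exact mul_ne_zero (by linarith) ha
  -- The central binomial term is a constant function: it adds to δ only.
  have h := (HasTransform.one.const_mul (((2 * n).choose n / 2 ^ (2 * n) : ℝ) : ℂ)).add
    ((hasTransform_sum_cos_div (Finset.range n) (fun k => ((2 * n).choose k : ℝ)) _
    hb).const_mul ((1 / 2 ^ (2 * n - 1) : ℝ) : ℂ))
  have h0 := cos_pow_even 0 hn
  simp only [mul_zero, Real.cos_zero, one_pow, mul_one] at h0
  convert h using 1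
  · ext x
    rw [cos_pow_even _ hn, mul_one, ← Complex.ofReal_mul, ← Complex.ofReal_add]
    simp only [mul_div_assoc]
  · have h1 := congrArg Complex.ofReal h0
    rw [Complex.ofReal_add, Complex.ofReal_mul, Complex.ofReal_one] at h1
    linear_combination (2 * Real.pi : ℂ) * h1
  · ext s
    rw [← Complex.ofReal_mul, mul_zero, zero_add]
    congr 1
    ring

/-! ### Truncated integrals -/

theorem integral_symm_eq {F : ℝ → ℂ} {G : ℝ → ℝ} {R : ℝ}
    (hF : IntervalIntegrable F volume 0 R) (hF' : IntervalIntegrable F volume (-R) 0)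
    (h : ∀ t, F t + F (-t) = ((2 * G t : ℝ) : ℂ)) :
    ∫ t in (-R)..R, F t = ((2 * ∫ t in (0 : ℝ)..R, G t : ℝ) : ℂ) := by
  have h1 : ∫ t in (0 : ℝ)..R, F (-t) = ∫ t in (-R)..0, F t := by
    rw [intervalIntegral.integral_comp_neg, neg_zero]
  have h2 : IntervalIntegrable (fun t => F (-t)) volume 0 R := by
    have := (IntervalIntegrable.iff_comp_neg (by simp)).1 hF'
    rw [neg_neg, neg_zero] at this
    exact this.symm
  rw [← intervalIntegral.integral_add_adjacent_intervals hF' hF, ← h1, add_comm,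
    ← intervalIntegral.integral_add hF h2]
  simp_rw [h]
  rw [intervalIntegral.integral_ofReal, intervalIntegral.integral_const_mul]

theorem intervalIntegrable_of_norm_le {F : ℝ → ℂ} (hm : Measurable F) {C : ℝ}
    (hC : ∀ x, ‖F x‖ ≤ C) (a b : ℝ) : IntervalIntegrable F volume a b :=
  (intervalIntegrable_const (c := C)).mono_fun' hm.aestronglyMeasurable
    (Eventually.of_forall hC)

theorem cexp_neg_add_cexp (s t : ℝ) :
    Complex.exp (-(Complex.I * s * t)) + Complex.exp (-(Complex.I * s * ((-t : ℝ) : ℂ))) =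
      ((2 * Real.cos (s * t) : ℝ) : ℂ) := by
  push_cast
  rw [Complex.two_cos, add_comm]
  congr 2 <;> ring

theorem integral_cexp_mul_half_cos_div (a R s : ℝ) :
    ∫ t in (-R)..R, Complex.exp (-(Complex.I * s * t)) *
        (1 / 2 * ((Real.cos (a / t) : ℝ) : ℂ)) =
      ((∫ t in (0 : ℝ)..R, Real.cos (s * t) * Real.cos (a / t) : ℝ) : ℂ) := by
  have hi := intervalIntegrable_of_norm_le (F := fun t : ℝ => Complex.exp (-(Complex.I * s * t)) *
        (1 / 2 * ((Real.cos (a / t) : ℝ) : ℂ))) (by fun_prop) (C := 1) (fun t => by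
    rw [norm_mul, norm_kernel, norm_mul, Complex.norm_real, one_mul]
    have := Real.abs_cos_le_one (a / t)
    norm_num
    linarith)
  rw [integral_symm_eq (hi _ _) (hi _ _) (G := fun t => 1 / 2 * (Real.cos (s * t) *
    Real.cos (a / t))) (fun t => ?_), intervalIntegral.integral_const_mul]
  · congr 1
    ring
  · rw [div_neg, Real.cos_neg, ← add_mul, cexp_neg_add_cexp]
    push_cast
    ring

/-- The phase st - a/t is odd in t, so the imaginary part integrates to zero over a symmetric
interval. -/
theorem integral_cexp_mul_cexp_div (a R s : ℝ) :
    ∫ t in (-R)..R, Complex.exp (-(Complex.I * s * t)) *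
        Complex.exp (((a / t : ℝ) : ℂ) * Complex.I) =
      ((∫ t in (-R)..R, Real.cos (s * t - a / t) : ℝ) : ℂ) := by
  have hi := intervalIntegrable_of_norm_le (F := fun t : ℝ => Complex.exp (-(Complex.I * s * t)) *
        Complex.exp (((a / t : ℝ) : ℂ) * Complex.I)) (by fun_prop) (C := 1) (fun t => by
    rw [norm_mul, norm_kernel, Complex.norm_exp_ofReal_mul_I, one_mul])
  have hi' := intervalIntegrable_of_norm_le
    (F := fun t : ℝ => ((Real.cos (s * t - a / t) : ℝ) : ℂ)) (by fun_prop) (C := 1) (fun t => by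
    rw [Complex.norm_real]
    exact Real.abs_cos_le_one _)
  rw [integral_symm_eq (hi _ _) (hi _ _) (G := fun t => Real.cos (s * t - a / t)) (fun t => ?_),
    ← intervalIntegral.integral_ofReal,
    integral_symm_eq (hi' _ _) (hi' _ _) (G := fun t => Real.cos (s * t - a / t)) (fun t => ?_)]
  · rw [div_neg, mul_neg, sub_neg_eq_add, ← Complex.ofReal_add, ← Real.cos_neg (-(s * t) + a / t),
      show -(-(s * t) + a / t) = s * t - a / t by ring, two_mul]
  · rw [← Complex.exp_add, ← Complex.exp_add, div_neg]
    push_cast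
    rw [Complex.two_cos, add_comm]
    congr 2 <;> ring

/-- The substitution t ↦ 1/t carries (r, ∞) onto (0, 1/r) and absorbs dt/t². -/
theorem integral_Ioi_cos_div_mul_cos_div_sq (a s : ℝ) {r : ℝ} (hr : 0 < r) :
    ∫ t in Ioi r, Real.cos (s / t) * Real.cos (a * t) / t ^ 2 =
      ∫ t in (0 : ℝ)..r⁻¹, Real.cos (s * t) * Real.cos (a / t) := by
  have h := integral_image_eq_integral_abs_deriv_smul (s := Ioi r) (f := fun t : ℝ => t⁻¹)
    measurableSet_Ioi (fun t ht => (hasDerivAt_inv (hr.trans ht).ne').hasDerivWithinAt)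
    inv_injective.injOn (fun t => Real.cos (s * t) * Real.cos (a / t))
  have him : (fun t : ℝ => t⁻¹) '' Ioi r = Ioo 0 r⁻¹ := by
    rw [image_inv_eq_inv, inv_Ioi₀ hr]
  rw [him] at h
  rw [intervalIntegral.integral_of_le (inv_nonneg.2 hr.le), integral_Ioc_eq_integral_Ioo, h]
  refine setIntegral_congr_fun measurableSet_Ioi fun t ht => ?_
  have ht0 : 0 < t := hr.trans ht
  simp only [smul_eq_mul]
  rw [abs_neg, abs_of_nonneg (by positivity), div_inv_eq_mul, ← div_eq_mul_inv]
  ring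

/-- Applied to half of cos(a/t), because the even integrand over [-R, R] counts [0, R] twice. -/
theorem tendstoDeltaAdd_integral_cos_mul_cos_div {a : ℝ} (ha : a ≠ 0) :
    TendstoDeltaAdd
      (fun R s : ℝ => ((∫ t in (0 : ℝ)..R, Real.cos (s * t) * Real.cos (a / t) : ℝ) : ℂ)) atTop
      Real.pi
      (fun s : ℝ => ((-(Real.pi * √|a| * besselJ 1 (2 * √|a * s|) / (2 * √|s|)) : ℝ) : ℂ)) := by
  have h := ((hasTransform_cos_div ha).const_mul (1 / 2)).tendstoDeltaAdd
    ((memLp_cos_div a).const_mul (1 / 2))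
  have e1 : (1 / 2 * (2 * Real.pi) : ℂ) = Real.pi := by ring
  have e2 : ∀ s : ℝ, (1 / 2 : ℂ) *
      ((-(Real.pi * √|a| * besselJ 1 (2 * √|a * s|) / √|s|) : ℝ) : ℂ) =
      ((-(Real.pi * √|a| * besselJ 1 (2 * √|a * s|) / (2 * √|s|)) : ℝ) : ℂ) := by
    intro s
    rw [mul_comm (2 : ℝ), ← div_div]
    push_cast
    ring
  simp only [e1, e2] at h
  exact h.congr_comp tendsto_id
    (Eventually.of_forall fun R s => integral_cexp_mul_half_cos_div a R s)

end BoundedFourier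

end

theorem mainTheorem10 (a : ℝ) (ha : a ≠ 0) :
    -- `f(x) = cos(a/x)`: bounded, in no other Lebesgue space, and not of bounded variation
    (MemLp (fun x : ℝ => ((Real.cos (a / x) : ℝ) : ℂ)) ∞ volume ∧
      (∀ p : ℝ≥0∞, p ≠ 0 → p ≠ ∞ →
        ¬ MemLp (fun x : ℝ => ((Real.cos (a / x) : ℝ) : ℂ)) p volume) ∧
      ¬ BoundedVariationOn (fun x : ℝ => Real.cos (a / x)) univ) ∧
    -- the integral `∫ e^{-ist} cos(a/t) dt` diverges for each `s`
    (∀ s : ℝ,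
      ¬ BoundedFourier.HKIntegrable
          (fun t : ℝ => Complex.exp (-(Complex.I * s * t)) * ((Real.cos (a / t) : ℝ) : ℂ)) ∧
      (∀ n : ℕ, 1 ≤ n → ¬ BoundedFourier.DistribIntegrable n
          (fun t : ℝ => Complex.exp (-(Complex.I * s * t)) * ((Real.cos (a / t) : ℝ) : ℂ))) ∧
      (∀ p : ℝ≥0∞, 1 ≤ p → p ≠ ∞ → ¬ BoundedFourier.LpPrimitiveIntegrable p
          (fun t : ℝ => Complex.exp (-(Complex.I * s * t)) * ((Real.cos (a / t) : ℝ) : ℂ)))) ∧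
    -- the transform of `cos(a/x)`
    (∃ hf : MemLp (fun x : ℝ => ((Real.cos (a / x) : ℝ) : ℂ)) ∞ volume,
      BoundedFourier.EqDeltaAdd (BoundedFourier.fourier _ hf) (2 * Real.pi)
        (fun s : ℝ => ((-(Real.pi * √|a| * BoundedFourier.besselJ 1 (2 * √|a * s|) / √|s|) : ℝ)
          : ℂ))) ∧
    -- the value of `∫_0^∞ cos(st) cos(a/t) dt = ∫_0^∞ cos(s/t) cos(at) dt/t²`
    BoundedFourier.TendstoDeltaAdd
      (fun R s : ℝ => ((∫ t in (0 : ℝ)..R, Real.cos (s * t) * Real.cos (a / t) : ℝ) : ℂ)) atTop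
      Real.pi
      (fun s : ℝ => ((-(Real.pi * √|a| * BoundedFourier.besselJ 1 (2 * √|a * s|) / (2 * √|s|)) : ℝ)
        : ℂ)) ∧
    BoundedFourier.TendstoDeltaAdd
      (fun r s : ℝ => ((∫ t in Ioi r, Real.cos (s / t) * Real.cos (a * t) / t ^ 2 : ℝ) : ℂ))
      (𝓝[>] 0) Real.pi
      (fun s : ℝ => ((-(Real.pi * √|a| * BoundedFourier.besselJ 1 (2 * √|a * s|) / (2 * √|s|)) : ℝ)
        : ℂ)) ∧
    -- the transform of `e^{ia/x}`, also as `∫ cos(st - a/t) dt`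
    (∃ hg : MemLp (fun x : ℝ => Complex.exp (((a / x : ℝ) : ℂ) * Complex.I)) ∞ volume,
      BoundedFourier.EqDeltaAdd (BoundedFourier.fourier _ hg) (2 * Real.pi)
        (fun s : ℝ => ((-(if a * s < 0 then
          2 * Real.pi * √|a| * BoundedFourier.besselJ 1 (2 * √|a * s|) / √|s| else 0) : ℝ) : ℂ))) ∧
    BoundedFourier.TendstoDeltaAdd
      (fun R s : ℝ => ((∫ t in (-R)..R, Real.cos (s * t - a / t) : ℝ) : ℂ)) atTop
      (2 * Real.pi)
      (fun s : ℝ => ((-(if a * s < 0 then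
          2 * Real.pi * √|a| * BoundedFourier.besselJ 1 (2 * √|a * s|) / √|s| else 0) : ℝ) : ℂ)) ∧
    -- the transform of `x sin(a/x)`
    (∃ hh : MemLp (fun x : ℝ => ((x * Real.sin (a / x) : ℝ) : ℂ)) ∞ volume,
      BoundedFourier.EqDeltaAdd (BoundedFourier.fourier _ hh) (2 * Real.pi * a)
        (fun s : ℝ => ((Real.pi * a * BoundedFourier.besselJ 0 (2 * √|a * s|) / |s| -
          Real.pi * √|a| * Real.sign a * BoundedFourier.besselJ 1 (2 * √|a * s|)
            / |s| ^ (3 / 2 : ℝ) : ℝ) : ℂ))) ∧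
    -- the transforms of the odd and even powers of `cos(a/x)`
    (∀ n : ℕ, 1 ≤ n →
      (∃ hm : MemLp (fun x : ℝ => ((Real.cos (a / x) ^ (2 * n - 1) : ℝ) : ℂ)) ∞ volume,
        BoundedFourier.EqDeltaAdd (BoundedFourier.fourier _ hm) (2 * Real.pi)
          (fun s : ℝ => ((-(Real.pi / 2 ^ (2 * n - 2) * ∑ k ∈ Finset.range n,
            ((2 * n - 1).choose k : ℝ) * √|(2 * n - 2 * k - 1) * a / s| *
              BoundedFourier.besselJ 1 (2 * √|(2 * n - 2 * k - 1) * a * s|)) : ℝ) : ℂ))) ∧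
      (∃ hm : MemLp (fun x : ℝ => ((Real.cos (a / x) ^ (2 * n) : ℝ) : ℂ)) ∞ volume,
        BoundedFourier.EqDeltaAdd (BoundedFourier.fourier _ hm) (2 * Real.pi)
          (fun s : ℝ => ((-(Real.pi / 2 ^ (2 * n - 1) * ∑ k ∈ Finset.range n,
            ((2 * n).choose k : ℝ) * √|(2 * n - 2 * k) * a / s| *
              BoundedFourier.besselJ 1 (2 * √|(2 * n - 2 * k) * a * s|)) : ℝ) : ℂ)))) := by
  refine ⟨⟨BoundedFourier.memLp_cos_div a, BoundedFourier.not_memLp_cos_div a,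
    BoundedFourier.not_boundedVariationOn_cos_div ha⟩, fun s =>
    ⟨BoundedFourier.not_hkIntegrable_exp_mul_cos_div a s,
      fun n hn => BoundedFourier.not_distribIntegrable_exp_mul_cos_div a s hn,
      fun p h1 hp => BoundedFourier.not_lpPrimitiveIntegrable_exp_mul_cos_div a s h1 hp⟩,
    ⟨_, (BoundedFourier.hasTransform_cos_div ha).eqDeltaAdd (BoundedFourier.memLp_cos_div a)⟩,
    BoundedFourier.tendstoDeltaAdd_integral_cos_mul_cos_div ha,
    (BoundedFourier.tendstoDeltaAdd_integral_cos_mul_cos_div ha).congr_comp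
      tendsto_inv_nhdsGT_zero ?_, ?_, ?_,
    ⟨_, (BoundedFourier.hasTransform_mul_sin_div ha).eqDeltaAdd
      (BoundedFourier.memLp_mul_sin_div a)⟩, fun n hn =>
    ⟨⟨_, (BoundedFourier.hasTransform_cos_div_pow_odd ha hn).eqDeltaAdd
        (BoundedFourier.memLp_cos_div_pow a _)⟩,
      ⟨_, (BoundedFourier.hasTransform_cos_div_pow_even ha hn).eqDeltaAdd
        (BoundedFourier.memLp_cos_div_pow a _)⟩⟩⟩
  · filter_upwards [self_mem_nhdsWithin] with r hr s
    rw [BoundedFourier.integral_Ioi_cos_div_mul_cos_div_sq a s hr]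
  · simp only [← BoundedFourier.two_mul_pi_mul_expKernel]
    exact ⟨BoundedFourier.memLp_cexp_div a, (BoundedFourier.hasTransform_cexp_div ha).eqDeltaAdd
      (BoundedFourier.memLp_cexp_div a)⟩
  · simp only [← BoundedFourier.two_mul_pi_mul_expKernel]
    exact ((BoundedFourier.hasTransform_cexp_div ha).tendstoDeltaAdd
      (BoundedFourier.memLp_cexp_div a)).congr_comp tendsto_id
        (Eventually.of_forall fun R s => BoundedFourier.integral_cexp_mul_cexp_div a R s)
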